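/- Let $X_1, X_2, \dots$ be a stationary and ergodic sequence of real random variables on a probability space $(\Omega,\mathcal F,\mathbb P)$, each with a density with respect to Lebesgue measure, such that $\mathbb{P}(X_1 = X_2) = 0$. Here stationary means that the finite-dimensional distributions are invariant under shifts, and ergodic means that for all $k \ge 1$ and all Borel sets $A \subset \mathbb{R}^{\mathbb{N}}$, if the events $E = \{(X_k, X_{k+1}, \dots) \in A\}$ and $\tilde E = \{(X_{k+1}, X_{k+2}, \dots) \in A\}$ satisfy $\mathbb{P}(E \,\triangle\, \tilde E) = 0$, then $\mathbb{P}(E) \in \{0, 1\}$. Let $K$ be the graph with vertices $v_0, v_1, v_2, \dots$ and edges $\{v_i, v_{i+1}\}$, $i \ge 0$. For $n \ge 1$ put $X_{k,n} = X_k$ for $1 \le k \le n$, and $X_{0,n} = X_{k,n} = \infty$ for $k > n$, and let $K_n(t)$, $t \in \mathbb{R}$, be the subcomplex of the simplices $\sigma \in K$ with $\max_{v_i \in \sigma} X_{i,n} \le t$. Let $\Delta = \{(x,y) \in [-\infty,\infty]^2 : -\infty < x < y \le \infty\}$. The persistence diagram $PD_0$ of $(K_n(t))_{t \in \mathbb{R}}$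 is the unique finite multiset of points of $\Delta$ such that the persistence module formed by the homology groups $H_0(K_n(t); \mathbb{Z}_2)$ and the maps induced by inclusion is isomorphic to $\bigoplus_{(b,d) \in PD_0} I(b,d)$, where the interval module $I(b,d)$ is $\mathbb{Z}_2$ at each $t$ with $b \le t < d$ and $0$ at all other $t$, with identity maps between the copies of $\mathbb{Z}_2$. Let $\xi_{0,n} = \sum_{(b,d) \in PD_0} \delta_{(b,d)}$, a random measure on $\Delta$, and let $\Delta_\ell = \{(x,y) \in \Delta : y - x > \ell\}$ for $\ell \ge 0$. Then there is a probability measure $\xi_0$ on $\Delta$ such that, almost surely, $\xi_{0,n}/\xi_{0,n}(\Delta)$ converges weakly to $\xi_0$ as $n \to \infty$ (so that $\xi_0$ is unique), and $$ \sup_{\ell \in [0,\infty)} \left| \frac{\xi_{0,n}(\Delta_\ell)}{\xi_{0,n}(\Delta)} - \xi_0(\Delta_\ell) \right| \to 0 \quad \text{almost surely}, \qquad n \to \infty. $$ -/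

import Mathlib

open MeasureTheory Filter Topology
open scoped DirectSum BoundedContinuousFunction

noncomputable section

namespace SublevelPersistence

/-! ### Persistence modules over the field with two elements -/

/-- A persistence module indexed by `ℝ`, with coefficients in `ZMod 2`. -/
structure PersistenceModule where
  space : ℝ → Type
  [addCommGroup : ∀ t, AddCommGroup (space t)]
  [module : ∀ t, Module (ZMod 2) (space t)]
  map : ∀ {s t : ℝ}, s ≤ t → (space s →ₗ[ZMod 2] space t)
  map_refl : ∀ (t : ℝ) (a : space t), map (le_refl t) a = a
  map_trans : ∀ {r s t : ℝ} (hrs : r ≤ s) (hst : s ≤ t) (a : space r),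
    map hst (map hrs a) = map (hrs.trans hst) a

attribute [instance] PersistenceModule.addCommGroup PersistenceModule.module

/-- Isomorphism of persistence modules: levelwise linear isomorphisms that commute with the
structure maps. -/
def PersistenceModule.Isomorphic (M N : PersistenceModule) : Prop :=
  ∃ e : ∀ t : ℝ, M.space t ≃ₗ[ZMod 2] N.space t,
    ∀ (s t : ℝ) (h : s ≤ t) (a : M.space s), e t (M.map h a) = N.map h (e s a)

/-- The direct sum of a family of persistence modules. -/
def PersistenceModule.directSum {ι : Type} (M : ι → PersistenceModule) : PersistenceModule where
  space t := ⨁ i, (M i).space t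
  map h := DirectSum.lmap fun i => (M i).map h
  map_refl t a := by
    have h : (fun i => (M i).map (le_refl t)) = fun _ => LinearMap.id := by
      funext i; ext a; exact (M i).map_refl t a
    rw [h, DirectSum.lmap_id]; rfl
  map_trans hrs hst a := by
    rw [← LinearMap.comp_apply, ← DirectSum.lmap_comp]
    congr 2
    funext i; ext a; exact (M i).map_trans hrs hst a

/-- The set `Δ = {(x, y) ∈ [-∞, ∞]² : -∞ < x < y ≤ ∞}`, with the subspace topology and its
Borel σ-algebra. -/
abbrev Delta : Type := {p : EReal × EReal // ⊥ < p.1 ∧ p.1 < p.2}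

/-- The set `Δ_ℓ` of the points `(x, y)` of `Δ` with lifetime `y - x > ℓ`. -/
def deltaLifetime (l : ℝ) : Set Delta := {p | (l : EReal) < p.1.2 - p.1.1}

open Classical in
/-- The space of the interval module `I(b, d)` at `t`: all of `ZMod 2` if `b ≤ t < d`, and `0`
otherwise. -/
def intervalSpace (p : Delta) (t : ℝ) : Submodule (ZMod 2) (ZMod 2) :=
  if p.1.1 ≤ (t : EReal) ∧ (t : EReal) < p.1.2 then ⊤ else ⊥

open Classical in
/-- The structure map of `I(b, d)` from `s` to `t`: the identity if `b ≤ s ≤ t < d`, and the zero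
map otherwise. -/
def intervalMap (p : Delta) {s t : ℝ} (h : s ≤ t) :
    intervalSpace p s →ₗ[ZMod 2] intervalSpace p t :=
  if hI : p.1.1 ≤ (s : EReal) ∧ (t : EReal) < p.1.2 then
    Submodule.inclusion (by
      have h' : (s : EReal) ≤ (t : EReal) := EReal.coe_le_coe_iff.2 h
      unfold intervalSpace
      rw [if_pos (show p.1.1 ≤ (t : EReal) ∧ (t : EReal) < p.1.2 from ⟨hI.1.trans h', hI.2⟩)]
      exact le_top)
  else 0

/-- The interval module `I(b, d)`. -/
def intervalModule (p : Delta) : PersistenceModule where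
  space t := intervalSpace p t
  map h := intervalMap p h
  map_refl t a := by
    by_cases hI : p.1.1 ≤ (t : EReal) ∧ (t : EReal) < p.1.2
    · simp only [intervalMap, dif_pos hI]; rfl
    · have ha : (a : ZMod 2) = 0 := by
        have := a.2
        simp only [intervalSpace, if_neg hI] at this
        simpa using this
      simp only [intervalMap, dif_neg hI]
      exact Subtype.ext ha.symm
  map_trans {r s t} hrs hst a := by
    have hrs' : (r : EReal) ≤ (s : EReal) := EReal.coe_le_coe_iff.2 hrs
    have hst' : (s : EReal) ≤ (t : EReal) := EReal.coe_le_coe_iff.2 hst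
    by_cases hI : p.1.1 ≤ (r : EReal) ∧ (t : EReal) < p.1.2
    · have h1 : p.1.1 ≤ (r : EReal) ∧ (s : EReal) < p.1.2 := ⟨hI.1, hst'.trans_lt hI.2⟩
      have h2 : p.1.1 ≤ (s : EReal) ∧ (t : EReal) < p.1.2 := ⟨hI.1.trans hrs', hI.2⟩
      simp only [intervalMap, dif_pos hI, dif_pos h1, dif_pos h2]; rfl
    · by_cases h1 : p.1.1 ≤ (r : EReal) ∧ (s : EReal) < p.1.2
      · have h2 : ¬ (p.1.1 ≤ (s : EReal) ∧ (t : EReal) < p.1.2) := fun h2 => hI ⟨h1.1, h2.2⟩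
        simp only [intervalMap, dif_neg hI, dif_neg h2]; rfl
      · simp only [intervalMap, dif_neg hI, dif_neg h1]
        exact map_zero _

/-! ### Homology of the sublevel filtration of the path graph

The graph has the vertices `v_0, v_1, v_2, …` and the edges `{v_i, v_{i+1}}`; the edge
`{v_i, v_{i+1}}` is indexed by `i`. A vertex function `x` with values in `(-∞, ∞]` is given, and
`K(t)` consists of the simplices on which `x` is at most `t`. -/

/-- The 0-chains of `K(t)`. -/
def chains0 (x : ℕ → EReal) (t : ℝ) : Submodule (ZMod 2) (ℕ →₀ ZMod 2) :=
  Finsupp.supported (ZMod 2) (ZMod 2) {i | x i ≤ (t : EReal)}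

/-- The 1-chains of `K(t)`. -/
def chains1 (x : ℕ → EReal) (t : ℝ) : Submodule (ZMod 2) (ℕ →₀ ZMod 2) :=
  Finsupp.supported (ZMod 2) (ZMod 2) {i | max (x i) (x (i + 1)) ≤ (t : EReal)}

/-- The boundary map, `{v_i, v_{i+1}} ↦ v_i + v_{i+1}`. -/
def boundary : (ℕ →₀ ZMod 2) →ₗ[ZMod 2] (ℕ →₀ ZMod 2) :=
  Finsupp.linearCombination (ZMod 2)
    fun i => Finsupp.single i (1 : ZMod 2) + Finsupp.single (i + 1) (1 : ZMod 2)

/-- The 0-boundaries of `K(t)`. -/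
def boundaries0 (x : ℕ → EReal) (t : ℝ) : Submodule (ZMod 2) (ℕ →₀ ZMod 2) :=
  (chains1 x t).map boundary

/-- The 0-boundaries of `K(t)` as a subspace of the space of its 0-chains. -/
def boundariesInChains (x : ℕ → EReal) (t : ℝ) : Submodule (ZMod 2) (chains0 x t) :=
  (boundaries0 x t).comap (chains0 x t).subtype

/-- The homology group `H_0(K(t))`; every 0-chain is a cycle. -/
def H0 (x : ℕ → EReal) (t : ℝ) : Type :=
  chains0 x t ⧸ boundariesInChains x t

instance (x : ℕ → EReal) (t : ℝ) : AddCommGroup (H0 x t) :=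
  Submodule.Quotient.addCommGroup (boundariesInChains x t)

instance (x : ℕ → EReal) (t : ℝ) : Module (ZMod 2) (H0 x t) :=
  Submodule.Quotient.module (boundariesInChains x t)

theorem chains0_mono (x : ℕ → EReal) {s t : ℝ} (h : s ≤ t) : chains0 x s ≤ chains0 x t :=
  Finsupp.supported_mono fun _ hi => le_trans hi (EReal.coe_le_coe_iff.2 h)

theorem boundaries0_mono (x : ℕ → EReal) {s t : ℝ} (h : s ≤ t) :
    boundaries0 x s ≤ boundaries0 x t :=
  Submodule.map_mono (Finsupp.supported_mono fun _ hi => le_trans hi (EReal.coe_le_coe_iff.2 h))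

/-- The map `H_0(K(s)) → H_0(K(t))` induced by the inclusion of `K(s)` in `K(t)`. -/
def H0map (x : ℕ → EReal) {s t : ℝ} (h : s ≤ t) : H0 x s →ₗ[ZMod 2] H0 x t :=
  Submodule.mapQ (boundariesInChains x s) (boundariesInChains x t)
    (Submodule.inclusion (chains0_mono x h))
    fun _ ha => boundaries0_mono x h ha

/-- The 0-dimensional persistent homology of the filtration `(K(t))_{t ∈ ℝ}`. -/
def PH0 (x : ℕ → EReal) : PersistenceModule where
  space t := H0 x t
  map h := H0map x h
  map_refl t a := by
    obtain ⟨c, rfl⟩ := Submodule.Quotient.mk_surjective _ a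
    rfl
  map_trans hrs hst a := by
    obtain ⟨c, rfl⟩ := Submodule.Quotient.mk_surjective _ a
    rfl

/-! ### Persistence diagrams -/

/-- `D` is a 0-th persistence diagram of the filtration: a finite multiset of points of `Δ` such
that `PH_0` is isomorphic to the direct sum of the interval modules `I(b, d)`, `(b, d) ∈ D`. -/
def IsPersistenceDiagram (x : ℕ → EReal) (D : Multiset Delta) : Prop :=
  ∃ (m : ℕ) (p : Fin m → Delta), D = Finset.univ.val.map p ∧
    (PH0 x).Isomorphic (PersistenceModule.directSum fun i => intervalModule (p i))

open Classical in
/-- The 0-th persistence diagram `PD_0` of the filtration. (It exists and is unique when only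
finitely many vertices have a finite value, as below; the empty multiset is a dummy value.) -/
def persistenceDiagram (x : ℕ → EReal) : Multiset Delta :=
  if h : ∃ D, IsPersistenceDiagram x D then h.choose else 0

/-- The vertex function of the first `n` terms of a sequence `x_1, x_2, …` (in Lean `x 0, x 1, …`):
`x_k` at the vertex `v_k` for `1 ≤ k ≤ n`, and `∞` at all other vertices. -/
def level (x : ℕ → ℝ) (n : ℕ) : ℕ → EReal
  | 0 => ⊤
  | k + 1 => if k < n then (x k : EReal) else ⊤

/-- The measure `ξ_{0,n}` on `Δ`: the sum of the Dirac measures at the points, counted with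
multiplicity, of the persistence diagram of the first `n` terms of the sequence. -/
def xi (x : ℕ → ℝ) (n : ℕ) : Measure Delta :=
  ((persistenceDiagram (level x n)).map Measure.dirac).sum

/-! ### Stationary and ergodic sequences

The sequence `X_1, X_2, …` of random variables is `X 0, X 1, …` in Lean. -/

variable {Ω : Type*} [MeasurableSpace Ω]

/-- Strict stationarity: the finite-dimensional distributions are invariant under shifts. -/
def IsStationary (P : Measure Ω) (X : ℕ → Ω → ℝ) : Prop :=
  ∀ (d k : ℕ) (A : Set (Fin d → ℝ)), MeasurableSet A →
    P {ω | (fun i : Fin d => X i ω) ∈ A} = P {ω | (fun i : Fin d => X (k + i) ω) ∈ A}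

/-- Ergodicity (of a stationary sequence): every almost surely shift-invariant event has
probability 0 or 1. -/
def IsErgodic (P : Measure Ω) (X : ℕ → Ω → ℝ) : Prop :=
  ∀ (k : ℕ) (A : Set (ℕ → ℝ)), MeasurableSet A →
    P (symmDiff {ω | (fun i => X (k + i) ω) ∈ A} {ω | (fun i => X (k + 1 + i) ω) ∈ A}) = 0 →
      P {ω | (fun i => X (k + i) ω) ∈ A} = 0 ∨ P {ω | (fun i => X (k + i) ω) ∈ A} = 1

end SublevelPersistence

end

noncomputable section

namespace SublevelPersistence

/-! ### Uniqueness of persistence diagrams -/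

/-! On a path, homology in degree zero follows the elder rule: the component born at a vertex dies
when it merges with an older one, at the minimum over older vertices of the maximum along the
connecting path (`death`). `exists_adapted` turns this into a basis of the chains adapted to cycles
and boundaries, and `xi_apply` then counts the terms whose birth and death lie in a given set. The
choice of a diagram is immaterial: the rank of the structure map from s to t counts the intervals
through s and t, and these counts determine the measure.

The death of a term is local: any window with a smaller term on each side determines it
(`death_shift`). A window of radius k does so with probability tending to 1
(`tendsto_measure_compl_enclosed`). For fixed k, Birkhoff's theorem gives the frequency of enclosed
terms with birth and death in B; letting k grow bounds the frequency of B from below by `limitLaw`.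
Since `limitLaw` has mass one, the same bound for the complement is the upper bound
(`ae_tendsto_card_div`).

Pairs with birth equal to death are not points of the diagram, so frequencies are divided by that of
Δ. It is positive: a local minimum has a positive lifetime, and a stationary ergodic sequence with
distinct neighbours cannot avoid local minima (`measure_localMin_pos`). Finally countably many sets
suffice (`exists_countable_determining`): finite unions of basic open sets yield weak convergence,
and rays of lifetimes at grid points yield uniformity, as in the Glivenko–Cantelli theorem. -/

theorem PersistenceModule.Isomorphic.symm {M N : PersistenceModule} (h : M.Isomorphic N) :
    N.Isomorphic M := by
  obtain ⟨e, he⟩ := h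
  refine ⟨fun t => (e t).symm, fun s t hst a => ?_⟩
  rw [LinearEquiv.symm_apply_eq, he, LinearEquiv.apply_symm_apply]

theorem PersistenceModule.Isomorphic.trans {M N K : PersistenceModule} (h : M.Isomorphic N)
    (h' : N.Isomorphic K) : M.Isomorphic K := by
  obtain ⟨e, he⟩ := h
  obtain ⟨f, hf⟩ := h'
  exact ⟨fun t => (e t).trans (f t), fun s t hst a => by
    simp only [LinearEquiv.trans_apply, he, hf]⟩

/-- Over `ZMod 2` an image of rank r has 2 ^ r elements, so cardinality serves as the rank invariant
and needs no dimension theory. -/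
theorem PersistenceModule.Isomorphic.card_range_map {M N : PersistenceModule}
    (h : M.Isomorphic N) {s t : ℝ} (hst : s ≤ t) :
    Nat.card (Set.range (M.map hst)) = Nat.card (Set.range (N.map hst)) := by
  obtain ⟨e, he⟩ := h
  have h1 : Set.range (N.map hst) = e t '' Set.range (M.map hst) := by
    ext b
    constructor
    · rintro ⟨a, rfl⟩
      exact ⟨M.map hst ((e s).symm a), ⟨_, rfl⟩, by rw [he, LinearEquiv.apply_symm_apply]⟩
    · rintro ⟨_, ⟨a, rfl⟩, rfl⟩
      exact ⟨e s a, (he _ _ _ _).symm⟩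
  rw [h1, Nat.card_image_of_injective (e t).injective]

open Classical in
theorem card_range_intervalMap (p : Delta) {s t : ℝ} (hst : s ≤ t) :
    Nat.card (Set.range (intervalMap p hst)) =
      if p.1.1 ≤ (s : EReal) ∧ (t : EReal) < p.1.2 then 2 else 1 := by
  split_ifs with hI
  · have hs : intervalSpace p s = ⊤ := by
      have h' : (s : EReal) ≤ (t : EReal) := EReal.coe_le_coe_iff.2 hst
      unfold intervalSpace
      rw [if_pos ⟨hI.1, h'.trans_lt hI.2⟩]
    have hinj : Function.Injective (intervalMap p hst) := by
      simp only [intervalMap, dif_pos hI]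
      exact Submodule.inclusion_injective _
    rw [← Set.image_univ, Nat.card_image_of_injective hinj, Nat.card_univ, hs,
      Nat.card_congr (Submodule.topEquiv (R := ZMod 2) (M := ZMod 2)).toEquiv, Nat.card_zmod]
  · simp only [intervalMap, dif_neg hI]
    have : Set.range (0 : intervalSpace p s →ₗ[ZMod 2] intervalSpace p t) = {0} := by
      ext b; simp [eq_comm]
    rw [this]; simp

theorem card_range_lmap {R ι : Type*} [Semiring R] [Fintype ι] {M N : ι → Type*}
    [∀ i, AddCommMonoid (M i)] [∀ i, AddCommMonoid (N i)] [∀ i, Module R (M i)]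
    [∀ i, Module R (N i)] (f : ∀ i, M i →ₗ[R] N i) :
    Nat.card (Set.range (DirectSum.lmap f)) = ∏ i, Nat.card (Set.range (f i)) := by
  classical
  have hE : (DirectSum.linearEquivFunOnFintype R ι N) ∘ (DirectSum.lmap f) =
      (Pi.map fun i => f i) ∘ (DirectSum.linearEquivFunOnFintype R ι M) := by
    funext a
    funext i
    rfl
  have h1 : DirectSum.linearEquivFunOnFintype R ι N '' Set.range (DirectSum.lmap f) =
      Set.pi Set.univ fun i => Set.range (f i) := by
    rw [← Set.range_comp, hE, (DirectSum.linearEquivFunOnFintype R ι M).surjective.range_comp,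
      Set.range_piMap]
  rw [← Nat.card_image_of_injective (DirectSum.linearEquivFunOnFintype R ι N).injective, h1,
    Nat.card_congr (Equiv.Set.univPi _), Nat.card_pi]

open Classical in
theorem card_range_directSum {m : ℕ} (p : Fin m → Delta) {s t : ℝ} (hst : s ≤ t) :
    Nat.card (Set.range ((PersistenceModule.directSum fun i => intervalModule (p i)).map hst)) =
      2 ^ (Finset.univ.filter
        fun i => (p i).1.1 ≤ (s : EReal) ∧ (t : EReal) < (p i).1.2).card := by
  have h2 := card_range_lmap fun i => (intervalModule (p i)).map hst
  have h3 : ∀ i, Nat.card (Set.range ((intervalModule (p i)).map hst)) =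
      if (p i).1.1 ≤ (s : EReal) ∧ (t : EReal) < (p i).1.2 then 2 else 1 :=
    fun i => card_range_intervalMap (p i) hst
  simp only [h3, Finset.prod_ite, Finset.prod_const, one_pow, mul_one] at h2
  exact h2

/-- The points of `Δ` whose interval contains `s` and `t`. -/
def corner (s t : ℝ) : Set Delta := {p | p.1.1 ≤ (s : EReal) ∧ (t : EReal) < p.1.2}

theorem measurableSet_corner (s t : ℝ) : MeasurableSet (corner s t) :=
  (measurableSet_le (measurable_fst.comp measurable_subtype_coe) measurable_const).inter
    (measurableSet_lt measurable_const (measurable_snd.comp measurable_subtype_coe))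

theorem isPiSystem_corner : IsPiSystem {C : Set Delta | ∃ s t : ℝ, s ≤ t ∧ C = corner s t} := by
  rintro _ ⟨s, t, hst, rfl⟩ _ ⟨s', t', hst', rfl⟩ -
  refine ⟨min s s', max t t', (min_le_left _ _).trans (hst.trans (le_max_left _ _)), ?_⟩
  ext p
  simp only [corner, Set.mem_inter_iff, Set.mem_ofPred_eq,
    EReal.coe_strictMono.monotone.map_min, EReal.coe_strictMono.monotone.map_max,
    le_min_iff, max_lt_iff]
  tauto

theorem exists_rat_mem_corner (p : Delta) :
    ∃ q : ℚ, p ∈ corner q q ∧ p.1.1 < ((q : ℝ) : EReal) := by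
  obtain ⟨q, h1, h2⟩ := EReal.lt_iff_exists_rat_btwn.1 p.2.2
  exact ⟨q, ⟨h1.le, h2⟩, h1⟩

theorem borel_delta_eq_generateFrom :
    (inferInstance : MeasurableSpace Delta) =
      MeasurableSpace.generateFrom {C : Set Delta | ∃ s t : ℝ, s ≤ t ∧ C = corner s t} := by
  apply le_antisymm
  · set m := MeasurableSpace.generateFrom {C : Set Delta | ∃ s t : ℝ, s ≤ t ∧ C = corner s t}
    have hc : ∀ s t : ℝ, s ≤ t → MeasurableSet[m] (corner s t) := fun s t hst =>
      MeasurableSpace.measurableSet_generateFrom ⟨s, t, hst, rfl⟩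
    have h1 : Measurable[m] fun p : Delta => p.1.1 := by
      refine measurable_of_Iic (mδ := m) fun a => ?_
      induction a with
      | bot =>
        convert @MeasurableSet.empty _ m
        ext p
        simp [p.2.1.ne']
      | top => convert @MeasurableSet.univ _ m; ext p; simp
      | coe s =>
        -- A half-plane is not a corner. Points that die at or before `s` are caught by a rational
        -- between birth and death, which is then at most `s`.
        have : (fun p : Delta => p.1.1) ⁻¹' Set.Iic (s : EReal) =
            corner s s ∪ ⋃ q : {q : ℚ // (q : ℝ) ≤ s}, corner q q := by
          ext p
          simp only [Set.mem_preimage, Set.mem_Iic, Set.mem_union, Set.mem_iUnion]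
          constructor
          · intro h
            by_cases h' : (s : EReal) < p.1.2
            · exact Or.inl ⟨h, h'⟩
            · obtain ⟨q, hq, -⟩ := exists_rat_mem_corner p
              exact Or.inr ⟨⟨q, EReal.coe_le_coe_iff.1 (hq.2.le.trans (not_lt.1 h'))⟩, hq⟩
          · rintro (h | ⟨⟨q, hq⟩, h⟩)
            · exact h.1
            · exact h.1.trans (EReal.coe_le_coe_iff.2 hq)
        rw [this]
        exact (hc s s le_rfl).union (MeasurableSet.iUnion fun q => hc _ _ le_rfl)
    have h2 : Measurable[m] fun p : Delta => p.1.2 := by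
      refine measurable_of_Ioi (mδ := m) fun a => ?_
      induction a with
      | bot =>
        convert @MeasurableSet.univ _ m
        ext p
        simp [p.2.1.trans p.2.2]
      | top => convert @MeasurableSet.empty _ m; ext p; simp
      | coe s =>
        have : (fun p : Delta => p.1.2) ⁻¹' Set.Ioi (s : EReal) =
            corner s s ∪ ⋃ q : {q : ℚ // s ≤ (q : ℝ)}, corner q q := by
          ext p
          simp only [Set.mem_preimage, Set.mem_Ioi, Set.mem_union, Set.mem_iUnion]
          constructor
          · intro h
            by_cases h' : p.1.1 ≤ (s : EReal)
            · exact Or.inl ⟨h', h⟩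
            · obtain ⟨q, hq, hq'⟩ := exists_rat_mem_corner p
              exact Or.inr ⟨⟨q, EReal.coe_le_coe_iff.1 ((not_le.1 h').le.trans hq'.le)⟩, hq⟩
          · rintro (h | ⟨⟨q, hq⟩, h⟩)
            · exact h.2
            · exact (EReal.coe_le_coe_iff.2 hq).trans_lt h.2
        rw [this]
        exact (hc s s le_rfl).union (MeasurableSet.iUnion fun q => hc _ _ le_rfl)
    have h3 : Measurable[m] fun p : Delta => (p.1.1, p.1.2) := h1.prodMk h2
    exact h3.comap_le
  · refine MeasurableSpace.generateFrom_le ?_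
    rintro _ ⟨s, t, -, rfl⟩
    exact measurableSet_corner s t

theorem measure_ext_of_corner {μ ν : Measure Delta} [IsFiniteMeasure μ]
    (h : ∀ s t : ℝ, s ≤ t → μ (corner s t) = ν (corner s t)) : μ = ν := by
  obtain ⟨f, hf⟩ := exists_surjective_nat ℚ
  refine Measure.ext_of_generateFrom_of_iUnion _ (fun i => corner (f i) (f i))
    borel_delta_eq_generateFrom isPiSystem_corner ?_ (fun i => ⟨_, _, le_rfl, rfl⟩)
    (fun i => measure_ne_top _ _) ?_
  · refine Set.eq_univ_of_forall fun p => ?_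
    obtain ⟨q, hq, -⟩ := exists_rat_mem_corner p
    obtain ⟨i, rfl⟩ := hf q
    exact Set.mem_iUnion.2 ⟨i, hq⟩
  · rintro _ ⟨s, t, hst, rfl⟩
    exact h s t hst

open Classical in
theorem sum_dirac_apply {ι α : Type*} [Fintype ι] [MeasurableSpace α] (p : ι → α) {B : Set α}
    (hB : MeasurableSet B) :
    (∑ i, Measure.dirac (p i)) B = ((Finset.univ.filter fun i => p i ∈ B).card : ENNReal) := by
  simp [Measure.dirac_apply' _ hB, Set.indicator_apply]

/-- The measures of two isomorphic sums of interval modules are equal. -/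
theorem sum_dirac_eq_of_isomorphic {m n : ℕ} (p : Fin m → Delta) (q : Fin n → Delta)
    (h : (PersistenceModule.directSum fun i => intervalModule (p i)).Isomorphic
      (PersistenceModule.directSum fun i => intervalModule (q i))) :
    ∑ i, Measure.dirac (p i) = ∑ i, Measure.dirac (q i) := by
  classical
  refine measure_ext_of_corner fun s t hst => ?_
  have h1 := h.card_range_map hst
  rw [card_range_directSum, card_range_directSum] at h1
  rw [sum_dirac_apply _ (measurableSet_corner s t), sum_dirac_apply _ (measurableSet_corner s t)]
  have h2 := Nat.pow_right_injective le_rfl h1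
  exact congrArg _ (by convert h2 using 2 <;> (ext i; simp only [Finset.mem_filter]; rfl))

/-- `persistenceDiagram` is an arbitrary choice; by uniqueness its measure can be computed from any
explicit decomposition. -/
theorem sum_map_dirac_persistenceDiagram {x : ℕ → EReal} {m : ℕ} (p : Fin m → Delta)
    (h : (PH0 x).Isomorphic (PersistenceModule.directSum fun i => intervalModule (p i))) :
    ((persistenceDiagram x).map Measure.dirac).sum = ∑ i, Measure.dirac (p i) := by
  have hex : ∃ D, IsPersistenceDiagram x D := ⟨_, m, p, rfl, h⟩
  obtain ⟨n, q, hD, hq⟩ := hex.choose_spec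
  rw [persistenceDiagram, dif_pos hex, hD, Multiset.map_map,
    sum_dirac_eq_of_isomorphic p q (h.symm.trans hq)]
  rfl

/-! ### Existence of persistence diagrams: the elder rule -/

theorem cond_of_mem_intervalSpace {p : Delta} {t : ℝ} {a : ZMod 2} (ha : a ∈ intervalSpace p t)
    (h0 : a ≠ 0) : p.1.1 ≤ (t : EReal) ∧ (t : EReal) < p.1.2 := by
  by_contra h
  rw [intervalSpace, if_neg h] at ha
  exact h0 ((Submodule.mem_bot _).1 ha)

theorem mem_intervalSpace {p : Delta} {t : ℝ}
    (h : p.1.1 ≤ (t : EReal) ∧ (t : EReal) < p.1.2) (a : ZMod 2) : a ∈ intervalSpace p t := by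
  rw [intervalSpace, if_pos h]
  trivial

/-- The homology class of a 0-chain. -/
def H0mk (x : ℕ → EReal) (t : ℝ) : chains0 x t →ₗ[ZMod 2] H0 x t := (boundariesInChains x t).mkQ

theorem H0mk_eq_zero {x : ℕ → EReal} {t : ℝ} {c : chains0 x t} :
    H0mk x t c = 0 ↔ (c : ℕ →₀ ZMod 2) ∈ boundaries0 x t :=
  Submodule.Quotient.mk_eq_zero (boundariesInChains x t)

theorem H0mk_surjective (x : ℕ → EReal) (t : ℝ) : Function.Surjective (H0mk x t) :=
  Submodule.Quotient.mk_surjective (boundariesInChains x t)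

theorem H0map_H0mk (x : ℕ → EReal) {s t : ℝ} (h : s ≤ t) (c : chains0 x s) :
    H0map x h (H0mk x s c) = H0mk x t (Submodule.inclusion (chains0_mono x h) c) := rfl

theorem isomorphic_directSum_of_equiv {x : ℕ → EReal} {m : ℕ} (p : Fin m → Delta)
    (e : ∀ t, (⨁ k, intervalSpace (p k) t) ≃ₗ[ZMod 2] H0 x t)
    (he : ∀ (s t : ℝ) (h : s ≤ t) (a : ⨁ k, intervalSpace (p k) s),
      e t (DirectSum.lmap (fun k => intervalMap (p k) h) a) = H0map x h (e s a)) :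
    (PH0 x).Isomorphic (PersistenceModule.directSum fun k => intervalModule (p k)) :=
  PersistenceModule.Isomorphic.symm ⟨e, he⟩

/-- A change of basis of the space of chains that is adapted to the filtrations by the cycles and
by the boundaries decomposes `PH_0` into interval modules. -/
theorem isomorphic_directSum_of_adapted {y d : ℕ → EReal}
    {Φ : (ℕ →₀ ZMod 2) →ₗ[ZMod 2] (ℕ →₀ ZMod 2)} (hΦ : Function.Injective Φ)
    (h0 : ∀ t : ℝ, (Finsupp.supported (ZMod 2) (ZMod 2) {i | y i ≤ (t : EReal)}).map Φ =
      chains0 y t)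
    (h1 : ∀ t : ℝ, (Finsupp.supported (ZMod 2) (ZMod 2) {i | d i ≤ (t : EReal)}).map Φ =
      boundaries0 y t)
    {m : ℕ} (p : Fin m → Delta) {idx : Fin m → ℕ} (hidx : Function.Injective idx)
    (hp : ∀ k, (p k).1 = (y (idx k), d (idx k)))
    (hrange : ∀ i, y i < d i → i ∈ Set.range idx) :
    (PH0 y).Isomorphic (PersistenceModule.directSum fun k => intervalModule (p k)) := by
  have hcond : ∀ k (t : ℝ), ((p k).1.1 ≤ (t : EReal) ∧ (t : EReal) < (p k).1.2) ↔
      y (idx k) ≤ (t : EReal) ∧ (t : EReal) < d (idx k) := fun k t => by rw [hp k]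
  have hsingle : ∀ i (t : ℝ), y i ≤ (t : EReal) → ∀ a : ZMod 2,
      Φ (Finsupp.single i a) ∈ chains0 y t := fun i t hi a => by
    rw [← h0 t]
    exact Submodule.mem_map_of_mem (Finsupp.single_mem_supported _ _ hi)
  have hsingle' : ∀ i (t : ℝ), d i ≤ (t : EReal) → ∀ a : ZMod 2,
      Φ (Finsupp.single i a) ∈ boundaries0 y t := fun i t hi a => by
    rw [← h1 t]
    exact Submodule.mem_map_of_mem (Finsupp.single_mem_supported _ _ hi)
  let g (t : ℝ) (k : Fin m) : intervalSpace (p k) t →ₗ[ZMod 2] chains0 y t :=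
    LinearMap.codRestrict _ (Φ ∘ₗ Finsupp.lsingle (idx k) ∘ₗ (intervalSpace (p k) t).subtype)
      (fun a => by
        by_cases ha : (a : ZMod 2) = 0
        · simp [ha]
        · exact hsingle _ _ ((hcond k t).1 (cond_of_mem_intervalSpace a.2 ha)).1 _)
  let G (t : ℝ) : (⨁ k, intervalSpace (p k) t) →ₗ[ZMod 2] chains0 y t :=
    DirectSum.toModule _ _ _ (g t)
  let F (t : ℝ) : (⨁ k, intervalSpace (p k) t) →ₗ[ZMod 2] H0 y t :=
    H0mk y t ∘ₗ G t
  -- `E` is the coordinate vector in the adapted basis. As `G t = Φ ∘ E t`, questions about chains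
  -- become questions about supports.
  let E (t : ℝ) : (⨁ k, intervalSpace (p k) t) →ₗ[ZMod 2] (ℕ →₀ ZMod 2) :=
    DirectSum.toModule _ _ _ fun k => Finsupp.lsingle (idx k) ∘ₗ (intervalSpace (p k) t).subtype
  have hGE : ∀ t, (chains0 y t).subtype ∘ₗ G t = Φ ∘ₗ E t := by
    intro t
    refine DirectSum.linearMap_ext _ fun k => LinearMap.ext fun a => ?_
    simp [G, E, g]
  have hE : ∀ t k, Finsupp.lapply (idx k) ∘ₗ E t =
      (intervalSpace (p k) t).subtype ∘ₗ DirectSum.component (ZMod 2) _ _ k := by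
    intro t k
    refine DirectSum.linearMap_ext _ fun j => LinearMap.ext fun a => ?_
    by_cases hjk : j = k
    · subst hjk
      simp [E]
    · simp [E, DirectSum.component.of, hjk, hidx.ne hjk]
  have hF : ∀ t k (a : intervalSpace (p k) t),
      F t (DirectSum.lof (ZMod 2) (Fin m) (fun k => intervalSpace (p k) t) k a) =
        H0mk y t (g t k a) := by
    intro t k a
    have hG : G t (DirectSum.lof (ZMod 2) (Fin m) (fun k => intervalSpace (p k) t) k a) =
        g t k a := by simp [G]
    rw [← hG]
    rfl
  -- A combination that is a boundary has its coordinates at indices already dead at `t`, whereas a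
  -- nonzero component sits at an index still alive.
  have hinj : ∀ t, Function.Injective (F t) := by
    intro t
    rw [injective_iff_map_eq_zero]
    intro a ha
    have ha2 : (G t a : ℕ →₀ ZMod 2) ∈ boundaries0 y t := H0mk_eq_zero.1 ha
    have ha3 : (G t a : ℕ →₀ ZMod 2) = Φ (E t a) := LinearMap.congr_fun (hGE t) a
    rw [ha3, ← h1 t] at ha2
    obtain ⟨z, hz, hz'⟩ := ha2
    rw [hΦ hz'] at hz
    refine DirectSum.ext_component (ZMod 2) fun k => ?_
    have hk : (E t a) (idx k) = (DirectSum.component (ZMod 2) _ _ k a : ZMod 2) :=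
      LinearMap.congr_fun (hE t k) a
    rw [map_zero]
    by_contra hne
    have hne' : (DirectSum.component (ZMod 2) _ _ k a : ZMod 2) ≠ 0 := fun h => hne (Subtype.ext h)
    have h2 := (hcond k t).1 (cond_of_mem_intervalSpace
      (DirectSum.component (ZMod 2) _ _ k a).2 hne')
    have h3 : idx k ∈ (E t a).support := Finsupp.mem_support_iff.2 (by rw [hk]; exact hne')
    exact absurd h2.2 (not_lt.2 ((Finsupp.mem_supported _ _).1 hz h3))
  -- The basis vectors born by time `t` span the chains; those already dead are boundaries, and the
  -- others come from the interval modules.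
  have hsurj : ∀ t, Function.Surjective (F t) := by
    intro t
    have key : chains0 y t ≤
        (((LinearMap.range (F t)).comap (H0mk y t)).map (chains0 y t).subtype) := by
      refine (h0 t).ge.trans ?_
      rw [Finsupp.supported_eq_span_single, Submodule.map_span, Submodule.span_le]
      rintro _ ⟨_, ⟨i, hi, rfl⟩, rfl⟩
      refine ⟨⟨_, hsingle i t hi 1⟩, ?_, rfl⟩
      by_cases hd : d i ≤ (t : EReal)
      · have : H0mk y t ⟨_, hsingle i t hi 1⟩ = 0 := H0mk_eq_zero.2 (hsingle' i t hd 1)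
        refine ⟨0, ?_⟩
        rw [this, map_zero]
      · obtain ⟨k, rfl⟩ := hrange i (lt_of_le_of_lt hi (not_le.1 hd))
        exact ⟨_, hF t k ⟨1, mem_intervalSpace ((hcond k t).2 ⟨hi, not_le.1 hd⟩) 1⟩⟩
    intro b
    obtain ⟨c, rfl⟩ := H0mk_surjective y t b
    obtain ⟨c', hc', hcc⟩ := key c.2
    rw [show c = c' from Subtype.ext hcc.symm]
    exact hc'
  refine isomorphic_directSum_of_equiv p
    (fun t => LinearEquiv.ofBijective (F t) ⟨hinj t, hsurj t⟩) fun s t hst a => ?_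
  have hnat : F t ∘ₗ DirectSum.lmap (fun k => intervalMap (p k) hst) = H0map y hst ∘ₗ F s := by
    refine DirectSum.linearMap_ext _ fun k => LinearMap.ext fun a => ?_
    have e1 : F t (DirectSum.lmap (fun k => intervalMap (p k) hst)
        (DirectSum.lof (ZMod 2) _ _ k a)) = H0mk y t (g t k (intervalMap (p k) hst a)) := by
      rw [DirectSum.lmap_lof]
      exact hF t k _
    have e2 : H0map y hst (F s (DirectSum.lof (ZMod 2) _ _ k a)) =
        H0mk y t (Submodule.inclusion (chains0_mono y hst) (g s k a)) := by
      rw [hF, H0map_H0mk]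
    refine e1.trans (Eq.trans ?_ e2.symm)
    by_cases ha : (a : ZMod 2) = 0
    · rw [show a = 0 from Subtype.ext ha]; simp
    have h2 := cond_of_mem_intervalSpace a.2 ha
    by_cases ht : (t : EReal) < (p k).1.2
    · congr 1
      refine Subtype.ext ?_
      simp only [intervalMap, dif_pos (And.intro h2.1 ht)]
      rfl
    · simp only [intervalMap, dif_neg fun h : _ ∧ _ => ht h.2, LinearMap.zero_apply, map_zero]
      refine (H0mk_eq_zero.2 ?_).symm
      exact hsingle' _ t (by simpa [hp k] using ht) _
  exact LinearMap.congr_fun hnat a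

/-- The vertex `v_j` is older than `v_i`: it appears earlier, ties being broken by the index. -/
def Elder (y : ℕ → EReal) (j i : ℕ) : Prop := toLex (y j, j) < toLex (y i, i)

theorem elder_iff {y : ℕ → EReal} {j i : ℕ} :
    Elder y j i ↔ y j < y i ∨ y j = y i ∧ j < i := Prod.Lex.toLex_lt_toLex

theorem Elder.le {y : ℕ → EReal} {j i : ℕ} (h : Elder y j i) : y j ≤ y i := by
  rcases elder_iff.1 h with h | h
  exacts [h.le, h.1.le]

theorem elder_trichotomy (y : ℕ → EReal) (i j : ℕ) : Elder y i j ∨ i = j ∨ Elder y j i := by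
  rcases lt_trichotomy (toLex (y i, i)) (toLex (y j, j)) with h | h | h
  · exact Or.inl h
  · exact Or.inr (Or.inl (congrArg (fun p => (ofLex p).2) h))
  · exact Or.inr (Or.inr h)

/-- The least `t` such that `v_i` and `v_j` are connected in `K(t)`. -/
def passMax (y : ℕ → EReal) (i j : ℕ) : EReal := (Finset.uIcc i j).sup y

theorem passMax_comm (y : ℕ → EReal) (i j : ℕ) : passMax y i j = passMax y j i := by
  rw [passMax, Finset.uIcc_comm, passMax]

theorem le_passMax_left (y : ℕ → EReal) (i j : ℕ) : y i ≤ passMax y i j :=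
  Finset.le_sup Finset.left_mem_uIcc

theorem mem_uIcc_iff_min_max {i j k : ℕ} :
    k ∈ Finset.uIcc i j ↔ min i j ≤ k ∧ k ≤ max i j := Finset.mem_uIcc

/-- The ultrametric inequality: on a line, the paths from `i` to `j` and from `j` to `k` cover the
one from `i` to `k`. -/
theorem passMax_triangle (y : ℕ → EReal) (i j k : ℕ) :
    passMax y i k ≤ max (passMax y i j) (passMax y j k) := by
  refine Finset.sup_le fun l hl => ?_
  have : l ∈ Finset.uIcc i j ∨ l ∈ Finset.uIcc j k := by
    simp only [mem_uIcc_iff_min_max] at hl ⊢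
    omega
  rcases this with h | h
  · exact le_max_of_le_left (Finset.le_sup h)
  · exact le_max_of_le_right (Finset.le_sup h)

theorem passMax_mono {y : ℕ → EReal} {i j k l : ℕ} (hi : i ∈ Finset.uIcc k l)
    (hj : j ∈ Finset.uIcc k l) : passMax y i j ≤ passMax y k l :=
  Finset.sup_mono (Finset.uIcc_subset_uIcc hi hj)

/-- The time at which the component born at `v_i` merges with an older one. -/
def death (y : ℕ → EReal) (i : ℕ) : EReal := ⨅ j, ⨅ (_ : Elder y j i), passMax y i j

theorem death_le {y : ℕ → EReal} {i j : ℕ} (h : Elder y j i) : death y i ≤ passMax y i j :=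
  iInf₂_le j h

theorem le_death (y : ℕ → EReal) (i : ℕ) : y i ≤ death y i :=
  le_iInf₂ fun j _ => le_passMax_left y i j

/-- The infimum is attained because a vertex of finite value has only finitely many elders. The
minimizer is the vertex that absorbs the component. -/
theorem exists_passMax_eq_death {y : ℕ → EReal} (hfin : {i | y i < ⊤}.Finite) {i : ℕ}
    (hi : death y i < ⊤) : ∃ j, Elder y j i ∧ passMax y i j = death y i := by
  have h1 : {j | Elder y j i}.Finite :=
    hfin.subset fun j hj => (Elder.le hj).trans_lt ((le_death y i).trans_lt hi)
  have h2 : {j | Elder y j i}.Nonempty := by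
    by_contra h
    rw [Set.not_nonempty_iff_eq_empty] at h
    refine hi.ne (iInf₂_eq_top.2 fun j hj => ?_)
    exact absurd (show j ∈ {j | Elder y j i} from hj) (by simp [h])
  obtain ⟨j, hj, hmin⟩ := Set.exists_min_image _ (passMax y i) h1 h2
  exact ⟨j, hj, le_antisymm (le_iInf₂ hmin) (death_le hj)⟩

/-- The number of elders serves as the induction parameter for the elder order. -/
theorem exists_rank {y : ℕ → EReal} (hfin : {i | y i < ⊤}.Finite) :
    ∃ r : ℕ → ℕ, ∀ i j, y i < ⊤ → Elder y j i → r j < r i := by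
  refine ⟨fun i => {j | Elder y j i}.ncard, fun i j hi hji => ?_⟩
  refine Set.ncard_lt_ncard ⟨fun k hk => lt_trans hk hji, fun h => ?_⟩
    (hfin.subset fun j hj => (Elder.le hj).trans_lt hi)
  exact lt_irrefl (toLex (y j, j)) (h hji)

theorem single_add_single_mem_boundaries0 {y : ℕ → EReal} {t : ℝ} {i j : ℕ}
    (h : passMax y i j ≤ (t : EReal)) :
    Finsupp.single i (1 : ZMod 2) + Finsupp.single j (1 : ZMod 2) ∈ boundaries0 y t := by
  wlog hij : i ≤ j generalizing i j
  · rw [add_comm]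
    exact this (by rwa [passMax_comm]) (le_of_not_ge hij)
  induction j, hij using Nat.le_induction with
  | base => rw [ZModModule.add_self]; exact Submodule.zero_mem _
  | succ j hij ih =>
    have h1 := ih ((passMax_mono Finset.left_mem_uIcc (by
      simp only [mem_uIcc_iff_min_max]; omega)).trans h)
    have h2 : Finsupp.single j (1 : ZMod 2) + Finsupp.single (j + 1) (1 : ZMod 2) ∈
        boundaries0 y t := by
      refine ⟨Finsupp.single j 1, Finsupp.single_mem_supported _ _ ?_, by simp [boundary]⟩
      refine (max_le ?_ ?_).trans h <;> refine Finset.le_sup ?_ <;>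
        simp only [mem_uIcc_iff_min_max] <;> omega
    have h3 := Submodule.add_mem _ h1 h2
    rwa [add_assoc, ← add_assoc (Finsupp.single j 1), ZModModule.add_self, zero_add] at h3

/-- The basis vector at `i` is `v_i + v_{par i}`, where `par i` is an elder reached at the death of
`i`, or `v_i` alone if the death is infinite. The change of basis is unitriangular for the elder
order, hence injective and compatible with the sublevel chains. The vector `v_i + v_{par i}` bounds
from the death time on, and such vectors span the boundaries by descent to parents. -/
theorem exists_adapted {y : ℕ → EReal} (hfin : {i | y i < ⊤}.Finite) :
    ∃ Φ : (ℕ →₀ ZMod 2) →ₗ[ZMod 2] (ℕ →₀ ZMod 2), Function.Injective Φ ∧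
      (∀ t : ℝ, (Finsupp.supported (ZMod 2) (ZMod 2) {i | y i ≤ (t : EReal)}).map Φ =
        chains0 y t) ∧
      (∀ t : ℝ, (Finsupp.supported (ZMod 2) (ZMod 2) {i | death y i ≤ (t : EReal)}).map Φ =
        boundaries0 y t) := by
  classical
  obtain ⟨r, hr⟩ := exists_rank hfin
  have hpar : ∀ i, ∃ j, death y i < ⊤ → Elder y j i ∧ passMax y i j = death y i := fun i => by
    by_cases hi : death y i < ⊤
    · obtain ⟨j, hj⟩ := exists_passMax_eq_death hfin hi
      exact ⟨j, fun _ => hj⟩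
    · exact ⟨0, fun h => absurd h hi⟩
  choose par hpar using hpar
  let e : ℕ → (ℕ →₀ ZMod 2) := fun i =>
    Finsupp.single i 1 + if death y i < ⊤ then Finsupp.single (par i) 1 else 0
  have he : ∀ i, death y i < ⊤ → e i = Finsupp.single i 1 + Finsupp.single (par i) 1 :=
    fun i hi => by simp only [e, if_pos hi]
  refine ⟨Finsupp.linearCombination (ZMod 2) e, ?_, fun t => ?_, fun t => ?_⟩
  · rw [injective_iff_map_eq_zero]
    intro c hc
    by_contra hne
    -- The coefficient at the youngest index of the support survives: another index of the support
    -- with parent `i` would be younger than `i`.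
    obtain ⟨i, hi, hmax⟩ := Finset.exists_max_image c.support (fun i => toLex (y i, i))
      (Finsupp.support_nonempty_iff.2 hne)
    have h1 : (Finsupp.linearCombination (ZMod 2) e c) i = c i := by
      rw [Finsupp.linearCombination_apply, Finsupp.sum, Finsupp.finsetSum_apply,
        Finset.sum_eq_single i]
      · by_cases hd : death y i < ⊤
        · have : par i ≠ i := fun h => by
            have h2 := (hpar i hd).1
            rw [h] at h2
            exact lt_irrefl _ h2
          simp [he i hd, this]
        · simp [e, hd]
      · intro k hk hki
        by_cases hd : death y k < ⊤
        · have : par k ≠ i := fun h => by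
            have h2 := (hpar k hd).1
            rw [h] at h2
            exact absurd h2 (not_lt.2 (hmax k hk))
          simp [he k hd, this, hki]
        · simp [e, hd, hki]
      · intro h
        exact absurd hi h
    rw [hc] at h1
    exact Finsupp.mem_support_iff.1 hi h1.symm
  · rw [← Finsupp.span_image_eq_map_linearCombination]
    apply le_antisymm
    · rw [Submodule.span_le]
      rintro _ ⟨i, hi, rfl⟩
      refine Submodule.add_mem _ (Finsupp.single_mem_supported _ _ hi) ?_
      split_ifs with hd
      · exact Finsupp.single_mem_supported _ _ ((hpar i hd).1.le.trans hi)
      · exact Submodule.zero_mem _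
    · rw [chains0, Finsupp.supported_eq_span_single, Submodule.span_le]
      have key : ∀ N i, r i ≤ N → y i ≤ (t : EReal) → Finsupp.single i (1 : ZMod 2) ∈
          Submodule.span (ZMod 2) (e '' {i | y i ≤ (t : EReal)}) := by
        intro N
        induction N with
        | zero =>
          intro i hN hi
          have hd : ¬ death y i < ⊤ := fun hd => by
            have := hr i (par i) (hi.trans_lt (EReal.coe_lt_top t)) (hpar i hd).1
            omega
          have : e i = Finsupp.single i 1 := by simp [e, hd]
          rw [← this]
          exact Submodule.subset_span ⟨i, hi, rfl⟩
        | succ N ih =>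
          intro i hN hi
          have hei : e i ∈ Submodule.span (ZMod 2) (e '' {i | y i ≤ (t : EReal)}) :=
            Submodule.subset_span ⟨i, hi, rfl⟩
          by_cases hd : death y i < ⊤
          · have h1 := hr i (par i) (hi.trans_lt (EReal.coe_lt_top t)) (hpar i hd).1
            have h2 := ih (par i) (by omega) ((hpar i hd).1.le.trans hi)
            rw [he i hd] at hei
            exact (Submodule.add_mem_iff_left _ h2).1 hei
          · have : e i = Finsupp.single i 1 := by simp [e, hd]
            rwa [this] at hei
      rintro _ ⟨i, hi, rfl⟩
      exact key _ i le_rfl hi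
  · rw [← Finsupp.span_image_eq_map_linearCombination]
    apply le_antisymm
    · rw [Submodule.span_le]
      rintro _ ⟨i, hi, rfl⟩
      have hd : death y i < ⊤ := lt_of_le_of_lt hi (EReal.coe_lt_top t)
      rw [he i hd]
      exact single_add_single_mem_boundaries0 ((hpar i hd).2.le.trans hi)
    · rw [boundaries0, chains1, boundary, ← Finsupp.span_image_eq_map_linearCombination,
        Submodule.span_le]
      -- Descent on the ranks: if `i` is the younger vertex, adding `e i` replaces it by `par i`,
      -- and the ultrametric inequality keeps the path below `t`.
      have key : ∀ N i j, r i + r j ≤ N → passMax y i j ≤ (t : EReal) →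
          Finsupp.single i (1 : ZMod 2) + Finsupp.single j (1 : ZMod 2) ∈
          Submodule.span (ZMod 2) (e '' {i | death y i ≤ (t : EReal)}) := by
        intro N
        induction N using Nat.strong_induction_on with
        | _ N ih =>
          intro i j hN hij
          wlog hor : i = j ∨ Elder y j i generalizing i j
          · rw [add_comm (Finsupp.single i 1)]
            refine this j i (by omega) (by rwa [passMax_comm]) ?_
            rcases elder_trichotomy y i j with h | h | h
            · exact Or.inr h
            · exact Or.inl h.symm
            · exact absurd (Or.inr h) hor
          rcases hor with rfl | hji
          · rw [ZModModule.add_self]; exact Submodule.zero_mem _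
          · have hdt : death y i ≤ (t : EReal) := (death_le hji).trans hij
            have hd : death y i < ⊤ := hdt.trans_lt (EReal.coe_lt_top t)
            have h1 : e i ∈ Submodule.span (ZMod 2) (e '' {i | death y i ≤ (t : EReal)}) :=
              Submodule.subset_span ⟨i, hdt, rfl⟩
            have h2 := hr i (par i) ((le_death y i).trans_lt hd) (hpar i hd).1
            have h3 := ih (r (par i) + r j) (by omega) (par i) j le_rfl
              ((passMax_triangle y (par i) i j).trans (max_le
                (by rw [passMax_comm]; exact (hpar i hd).2.le.trans hdt) hij))
            rw [he i hd] at h1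
            have h4 := Submodule.add_mem _ h1 h3
            rwa [add_assoc, ← add_assoc (Finsupp.single (par i) 1), ZModModule.add_self,
              zero_add] at h4
      rintro _ ⟨i, hi, rfl⟩
      refine key _ i (i + 1) le_rfl (Finset.sup_le fun k hk => le_trans ?_ hi)
      simp only [mem_uIcc_iff_min_max] at hk
      rcases (by omega : k = i ∨ k = i + 1) with rfl | rfl
      exacts [le_max_left _ _, le_max_right _ _]

/-! ### The persistence diagram of a finite sequence -/

/-- The birth and the death of the component of the `k`-th term among the first `n` terms. -/
def birthDeath (x : ℕ → ℝ) (n k : ℕ) : EReal × EReal :=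
  ((x k : EReal), death (level x n) (k + 1))

theorem level_succ_of_lt {x : ℕ → ℝ} {n k : ℕ} (h : k < n) : level x n (k + 1) = (x k : EReal) :=
  if_pos h

theorem finite_level_lt_top (x : ℕ → ℝ) (n : ℕ) : {i | level x n i < ⊤}.Finite := by
  refine (Set.finite_Iic n).subset fun i hi => ?_
  cases i with
  | zero => exact Nat.zero_le n
  | succ k =>
    by_contra h
    have : ¬ k < n := fun h' => h h'
    simp [level, this] at hi

open Classical in
-- By the elder rule every term yields a pair; those with birth equal to death lie outside Δ and
-- drop out of the image of `B`. The term `x k` sits at the vertex `k + 1`.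
theorem xi_apply (x : ℕ → ℝ) (n : ℕ) {B : Set Delta} (hB : MeasurableSet B) :
    xi x n B = (((Finset.range n).filter
      fun k => birthDeath x n k ∈ Subtype.val '' B).card : ENNReal) := by
  set S := (Finset.range n).filter fun k => (x k : EReal) < death (level x n) (k + 1) with hS
  have hmem : ∀ j : Fin S.card, ((S.equivFin.symm j : ℕ)) ∈ S := fun j => (S.equivFin.symm j).2
  have hlt : ∀ k ∈ S, k < n := fun k hk => Finset.mem_range.1 (Finset.mem_filter.1 hk).1
  let p : Fin S.card → Delta := fun j => ⟨birthDeath x n (S.equivFin.symm j),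
    EReal.bot_lt_coe _, (Finset.mem_filter.1 (hmem j)).2⟩
  obtain ⟨Φ, hΦ, h0, h1⟩ := exists_adapted (finite_level_lt_top x n)
  have hiso := isomorphic_directSum_of_adapted hΦ h0 h1 p
    (idx := fun j => (S.equivFin.symm j : ℕ) + 1)
    (fun i j hij => S.equivFin.symm.injective (Subtype.ext (Nat.succ_injective hij)))
    (fun j => by simp only [p, birthDeath, level_succ_of_lt (hlt _ (hmem j))])
    (fun i hi => by
      have hi' : i ∈ {i | level x n i < ⊤} := hi.trans_le le_top
      cases i with
      | zero => simp [level] at hi'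
      | succ k =>
        have hk : k < n := by
          by_contra h
          simp [level, h] at hi'
        rw [level_succ_of_lt hk] at hi
        have hkS : k ∈ S := Finset.mem_filter.2 ⟨Finset.mem_range.2 hk, hi⟩
        exact ⟨S.equivFin ⟨k, hkS⟩, by simp⟩)
  rw [xi, sum_map_dirac_persistenceDiagram p hiso, sum_dirac_apply p hB]
  congr 1
  refine Finset.card_bij (fun j _ => (S.equivFin.symm j : ℕ)) (fun j hj => ?_)
    (fun i _ j _ hij => S.equivFin.symm.injective (Subtype.ext hij)) (fun k hk => ?_)
  · exact Finset.mem_filter.2 ⟨Finset.mem_range.2 (hlt _ (hmem j)),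
      ⟨p j, (Finset.mem_filter.1 hj).2, rfl⟩⟩
  · obtain ⟨hk1, q, hq, hqk⟩ := Finset.mem_filter.1 hk
    have hkS : k ∈ S := Finset.mem_filter.2 ⟨hk1, by
      have := q.2.2
      rw [hqk] at this
      exact this⟩
    refine ⟨S.equivFin ⟨k, hkS⟩, Finset.mem_filter.2 ⟨Finset.mem_univ _, ?_⟩, by simp⟩
    have : p (S.equivFin ⟨k, hkS⟩) = q := Subtype.ext (by simp [p, hqk])
    rwa [this]

/-! ### Locality of the death time. -/

/-- A path that leaves the window passes through `a` or `b`, which are elders themselves and are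
reached no later. -/
theorem death_eq_iInf_window {y : ℕ → EReal} {a b i : ℕ} (ha : a < i) (hb : i < b)
    (hya : y a < y i) (hyb : y b < y i) :
    death y i = ⨅ j, ⨅ (_ : j ∈ Set.Icc a b ∧ Elder y j i), passMax y i j := by
  apply le_antisymm
  · exact le_iInf₂ fun j hj => death_le hj.2
  · refine le_iInf₂ fun j hj => ?_
    by_cases h1 : j < a
    · refine (iInf₂_le a ⟨⟨le_rfl, by omega⟩, elder_iff.2 (Or.inl hya)⟩).trans
        (passMax_mono Finset.left_mem_uIcc ?_)
      rw [mem_uIcc_iff_min_max]; omega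
    by_cases h2 : b < j
    · refine (iInf₂_le b ⟨⟨by omega, le_rfl⟩, elder_iff.2 (Or.inl hyb)⟩).trans
        (passMax_mono Finset.left_mem_uIcc ?_)
      rw [mem_uIcc_iff_min_max]; omega
    · exact iInf₂_le j ⟨⟨by omega, by omega⟩, hj⟩

theorem passMax_shift {y y' : ℕ → EReal} {a b c i j : ℕ}
    (h : ∀ k ∈ Set.Icc a b, y' k = y (k + c)) (hi : i ∈ Set.Icc a b) (hj : j ∈ Set.Icc a b) :
    passMax y (i + c) (j + c) = passMax y' i j := by
  obtain ⟨hi1, hi2⟩ := hi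
  obtain ⟨hj1, hj2⟩ := hj
  apply le_antisymm
  · refine Finset.sup_le fun k hk => ?_
    rw [mem_uIcc_iff_min_max] at hk
    obtain ⟨l, rfl⟩ : ∃ l, k = l + c := ⟨k - c, by omega⟩
    rw [← h l ⟨by omega, by omega⟩]
    refine Finset.le_sup ?_
    rw [mem_uIcc_iff_min_max]; omega
  · refine Finset.sup_le fun k hk => ?_
    rw [mem_uIcc_iff_min_max] at hk
    rw [h k ⟨by omega, by omega⟩]
    refine Finset.le_sup ?_
    rw [mem_uIcc_iff_min_max]; omega

/-- The death time at `i` only depends on a window that contains a smaller value on each side. -/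
theorem death_shift {y y' : ℕ → EReal} {a b c i : ℕ}
    (h : ∀ k ∈ Set.Icc a b, y' k = y (k + c)) (ha : a < i) (hb : i < b)
    (hya : y' a < y' i) (hyb : y' b < y' i) : death y (i + c) = death y' i := by
  have hi : i ∈ Set.Icc a b := ⟨ha.le, hb.le⟩
  have hai : a ∈ Set.Icc a b := ⟨le_rfl, by omega⟩
  have hbi : b ∈ Set.Icc a b := ⟨by omega, le_rfl⟩
  have hel : ∀ j ∈ Set.Icc a b, (Elder y (j + c) (i + c) ↔ Elder y' j i) := fun j hj => by
    rw [elder_iff, elder_iff, h j hj, h i hi, add_lt_add_iff_right]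
  rw [death_eq_iInf_window ha hb hya hyb,
    death_eq_iInf_window (y := y) (a := a + c) (b := b + c) (by omega) (by omega)
      (by rwa [← h a hai, ← h i hi]) (by rwa [← h b hbi, ← h i hi])]
  apply le_antisymm
  · refine le_iInf₂ fun j hj => ?_
    rw [← passMax_shift h hi hj.1]
    exact iInf₂_le (j + c) ⟨⟨Nat.add_le_add_right hj.1.1 c, Nat.add_le_add_right hj.1.2 c⟩,
      (hel j hj.1).2 hj.2⟩
  · refine le_iInf₂ fun j hj => ?_
    obtain ⟨⟨hj1, hj2⟩, hj3⟩ := hj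
    obtain ⟨l, rfl⟩ : ∃ l, j = l + c := ⟨j - c, by omega⟩
    have hl : l ∈ Set.Icc a b := ⟨by omega, by omega⟩
    rw [passMax_shift h hi hl]
    exact iInf₂_le l ⟨hl, (hel l hl).1 hj3⟩

/-- The shift of a sequence. -/
def shift (x : ℕ → ℝ) : ℕ → ℝ := fun i => x (i + 1)

theorem iterate_shift (m : ℕ) (x : ℕ → ℝ) (i : ℕ) : shift^[m] x i = x (i + m) := by
  induction m generalizing x with
  | zero => rfl
  | succ m ih => rw [Function.iterate_succ_apply, ih, shift, add_assoc]

/-- The sequences with a term smaller than `x k` on each side of `k` at distance at most `k`. -/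
def enclosed (k : ℕ) : Set (ℕ → ℝ) :=
  {x | (∃ j < k, x j < x k) ∧ ∃ j ≤ k, x (k + j) < x k}

/-- This makes the pair of the term `i` a fixed function of the shifted sequence, independent of
`n`, to which the ergodic theorem applies. -/
theorem birthDeath_eq_of_enclosed {x : ℕ → ℝ} {n k i : ℕ} (hki : k ≤ i) (hin : i + k < n)
    (h : shift^[i - k] x ∈ enclosed k) :
    birthDeath x n i = birthDeath (shift^[i - k] x) (2 * k + 1) k := by
  obtain ⟨⟨a, ha, hxa⟩, b, hb, hxb⟩ := h
  have hb0 : b ≠ 0 := by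
    rintro rfl
    exact lt_irrefl _ hxb
  -- Vertex indices exceed term indices by one, so the window avoids the vertex 0, whose value is
  -- `⊤` and not a term of the sequence.
  have hd := death_shift (y := level x n) (y' := level (shift^[i - k] x) (2 * k + 1))
    (a := a + 1) (b := k + b + 1) (c := i - k) (i := k + 1) ?_ (by omega) (by omega) ?_ ?_
  · rw [birthDeath, birthDeath, ← hd, iterate_shift]
    rw [show k + (i - k) = i by omega, show k + 1 + (i - k) = i + 1 by omega]
  · rintro j ⟨hj1, hj2⟩
    obtain ⟨l, rfl⟩ : ∃ l, j = l + 1 := ⟨j - 1, by omega⟩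
    rw [level_succ_of_lt (by omega), iterate_shift, show l + 1 + (i - k) = l + (i - k) + 1 by omega,
      level_succ_of_lt (by omega)]
  · rw [level_succ_of_lt (by omega), level_succ_of_lt (by omega)]
    exact EReal.coe_lt_coe_iff.2 hxa
  · rw [level_succ_of_lt (by omega), level_succ_of_lt (by omega)]
    exact EReal.coe_lt_coe_iff.2 hxb

/-- Every path that leaves a strict local minimum crosses one of its two larger neighbours. -/
theorem lt_death_of_isolated {x : ℕ → ℝ} {n k : ℕ} (hn : k + 2 < n) (h1 : x (k + 1) < x k)
    (h2 : x (k + 1) < x (k + 2)) : (x (k + 1) : EReal) < death (level x n) (k + 2) := by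
  have h : (x (k + 1) : EReal) < min (x k : EReal) (x (k + 2) : EReal) :=
    lt_min (EReal.coe_lt_coe_iff.2 h1) (EReal.coe_lt_coe_iff.2 h2)
  refine h.trans_le (le_iInf₂ fun j hj => ?_)
  have hne : j ≠ k + 2 := by
    rintro rfl
    exact lt_irrefl _ hj
  rcases lt_or_gt_of_ne hne with hlt | hgt
  · refine (min_le_left _ _).trans ?_
    rw [← level_succ_of_lt (x := x) (n := n) (k := k) (by omega)]
    refine Finset.le_sup ?_
    rw [mem_uIcc_iff_min_max]; omega
  · refine (min_le_right _ _).trans ?_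
    rw [← level_succ_of_lt (x := x) (n := n) (k := k + 2) (by omega)]
    refine Finset.le_sup ?_
    rw [mem_uIcc_iff_min_max]; omega

/-! ### Measurability of births, deaths and enclosure. -/

theorem measurable_shift : Measurable shift := measurable_pi_lambda _ fun _ => measurable_pi_apply _

theorem measurable_level (n i : ℕ) : Measurable fun x : ℕ → ℝ => level x n i := by
  cases i with
  | zero => exact measurable_const
  | succ k =>
    by_cases h : k < n
    · simp only [level, if_pos h]
      exact measurable_coe_real_ereal.comp (measurable_pi_apply k)
    · simp only [level, if_neg h]
      exact measurable_const

theorem measurable_birthDeath (n k : ℕ) : Measurable fun x : ℕ → ℝ => birthDeath x n k := by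
  classical
  refine (measurable_coe_real_ereal.comp (measurable_pi_apply k)).prodMk ?_
  refine Measurable.iInf fun j => ?_
  simp only [iInf_eq_if]
  refine Measurable.ite ?_ ?_ measurable_const
  · simp only [elder_iff]
    exact (measurableSet_lt (measurable_level n j) (measurable_level n (k + 1))).union
      ((measurableSet_eq_fun (measurable_level n j) (measurable_level n (k + 1))).inter
        (MeasurableSet.const _))
  · simp only [passMax, Finset.sup_eq_iSup]
    exact Measurable.iSup fun i => Measurable.iSup fun _ => measurable_level n i

theorem measurableSet_enclosed (k : ℕ) : MeasurableSet (enclosed k) := by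
  refine MeasurableSet.inter ?_ ?_
  · have : {x : ℕ → ℝ | ∃ j < k, x j < x k} = ⋃ j : Set.Iio k, {x | x j < x k} := by
      ext x; simp
    change MeasurableSet {x : ℕ → ℝ | ∃ j < k, x j < x k}
    rw [this]
    exact MeasurableSet.iUnion fun j =>
      measurableSet_lt (measurable_pi_apply _) (measurable_pi_apply _)
  · have : {x : ℕ → ℝ | ∃ j ≤ k, x (k + j) < x k} = ⋃ j : Set.Iic k, {x | x (k + j) < x k} := by
      ext x; simp
    change MeasurableSet {x : ℕ → ℝ | ∃ j ≤ k, x (k + j) < x k}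
    rw [this]
    exact MeasurableSet.iUnion fun j =>
      measurableSet_lt (measurable_pi_apply _) (measurable_pi_apply _)

/-! ### The pointwise ergodic theorem -/

/-- The maximum of the first Birkhoff sums, including the empty one. -/
def birkhoffMax (T : α → α) (f : α → ℝ) : ℕ → α → ℝ
  | 0, _ => 0
  | n + 1, x => max (birkhoffMax T f n x) (birkhoffSum T f (n + 1) x)

theorem birkhoffSum_le_birkhoffMax {α : Type*} {T : α → α} {f : α → ℝ} {k n : ℕ} (h : k ≤ n) (x : α) :
    birkhoffSum T f k x ≤ birkhoffMax T f n x := by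
  induction n with
  | zero => rw [Nat.le_zero.1 h]; simp [birkhoffMax]
  | succ n ih =>
    rcases Nat.le_succ_iff.1 h with h | rfl
    · exact (ih h).trans (le_max_left _ _)
    · exact le_max_right _ _

theorem birkhoffMax_nonneg {α : Type*} {T : α → α} {f : α → ℝ} (n : ℕ) (x : α) : 0 ≤ birkhoffMax T f n x := by
  simpa using birkhoffSum_le_birkhoffMax (T := T) (f := f) (Nat.zero_le n) x

theorem exists_birkhoffMax_eq {α : Type*} {T : α → α} {f : α → ℝ} (n : ℕ) (x : α) :
    ∃ k ≤ n, birkhoffMax T f n x = birkhoffSum T f k x := by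
  induction n with
  | zero => exact ⟨0, le_rfl, by simp [birkhoffMax]⟩
  | succ n ih =>
    rcases max_choice (birkhoffMax T f n x) (birkhoffSum T f (n + 1) x) with h | h
    · obtain ⟨k, hk, hk'⟩ := ih
      exact ⟨k, hk.trans (Nat.le_succ n), h.trans hk'⟩
    · exact ⟨n + 1, le_rfl, h⟩

section Ergodic

variable {α : Type*} [MeasurableSpace α] {μ : Measure α} {T : α → α} {f : α → ℝ}

theorem measurable_birkhoffSum (hT : Measurable T) (hf : Measurable f) (n : ℕ) :
    Measurable (birkhoffSum T f n) := by
  exact Finset.measurable_sum _ fun k _ => hf.comp (hT.iterate k)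

theorem integrable_birkhoffSum (hT : MeasurePreserving T μ μ) (hf : Integrable f μ) (n : ℕ) :
    Integrable (birkhoffSum T f n) μ := by
  exact integrable_finsetSum _ fun k _ => (hT.iterate k).integrable_comp_of_integrable hf

theorem measurable_birkhoffMax (hT : Measurable T) (hf : Measurable f) (n : ℕ) :
    Measurable (birkhoffMax T f n) := by
  induction n with
  | zero => exact measurable_const
  | succ n ih => exact ih.max (measurable_birkhoffSum hT hf (n + 1))

theorem integrable_birkhoffMax (hT : MeasurePreserving T μ μ) (hf : Integrable f μ) (n : ℕ) :
    Integrable (birkhoffMax T f n) μ := by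
  induction n with
  | zero => exact integrable_zero _ _ _
  | succ n ih => exact ih.sup (integrable_birkhoffSum hT hf (n + 1))

/-- The maximal ergodic inequality. -/
theorem setIntegral_birkhoffMax_pos_nonneg (hT : MeasurePreserving T μ μ) (hfm : Measurable f)
    (hf : Integrable f μ) (n : ℕ) : 0 ≤ ∫ x in {x | 0 < birkhoffMax T f n x}, f x ∂μ := by
  have hM := integrable_birkhoffMax hT hf n
  have hMT : Integrable (fun x => birkhoffMax T f n (T x)) μ := hT.integrable_comp_of_integrable hM
  have hS : MeasurableSet {x | 0 < birkhoffMax T f n x} :=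
    measurableSet_lt measurable_const (measurable_birkhoffMax hT.measurable hfm n)
  -- With M the maximum, M - M ∘ T has integral zero and lies below f on {M > 0}, as a positive M(x)
  -- is f(x) plus a shorter sum at T x. Elsewhere M(x) = 0 ≤ M(T x).
  have h0 : ∫ x, (birkhoffMax T f n x - birkhoffMax T f n (T x)) ∂μ = 0 := by
    rw [integral_sub hM hMT, sub_eq_zero]
    have := integral_map (μ := μ) hT.measurable.aemeasurable (f := birkhoffMax T f n)
      (by rw [hT.map_eq]; exact hM.aestronglyMeasurable)
    rwa [hT.map_eq] at this
  rw [← integral_indicator hS]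
  refine h0.symm.le.trans ?_
  refine integral_mono (hM.sub hMT) (hf.indicator hS) fun x => ?_
  by_cases hx : 0 < birkhoffMax T f n x
  · rw [Set.indicator_of_mem (show x ∈ {x | 0 < birkhoffMax T f n x} from hx)]
    obtain ⟨k, hk, hk'⟩ := exists_birkhoffMax_eq (T := T) (f := f) n x
    cases k with
    | zero => rw [hk'] at hx; simp at hx
    | succ k =>
      have := birkhoffSum_le_birkhoffMax (T := T) (f := f) (show k ≤ n by omega) (T x)
      rw [birkhoffSum_succ'] at hk'
      linarith
  · rw [Set.indicator_of_notMem (show x ∉ {x | 0 < birkhoffMax T f n x} from hx)]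
    have := birkhoffMax_nonneg (T := T) (f := f) n (T x)
    linarith

/-- The sets of the maximal inequality increase to a set of full measure, so dominated convergence
applies. -/
theorem integral_nonneg_of_birkhoffSum_pos (hT : MeasurePreserving T μ μ) (hfm : Measurable f)
    (hf : Integrable f μ) (h : ∀ᵐ x ∂μ, ∃ n, 0 < birkhoffSum T f n x) : 0 ≤ ∫ x, f x ∂μ := by
  have hS : ∀ n, MeasurableSet {x | 0 < birkhoffMax T f n x} := fun n =>
    measurableSet_lt measurable_const (measurable_birkhoffMax hT.measurable hfm n)
  have hlim : Tendsto (fun n => ∫ x, {x | 0 < birkhoffMax T f n x}.indicator f x ∂μ) atTop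
      (𝓝 (∫ x, f x ∂μ)) := by
    refine tendsto_integral_of_dominated_convergence (fun x => ‖f x‖)
      (fun n => (hf.indicator (hS n)).aestronglyMeasurable) hf.norm
      (fun n => Eventually.of_forall fun x => norm_indicator_le_norm_self _ _) ?_
    filter_upwards [h] with x ⟨N, hN⟩
    refine tendsto_const_nhds.congr' ?_
    filter_upwards [eventually_ge_atTop N] with n hn
    exact (Set.indicator_of_mem (show x ∈ {x | 0 < birkhoffMax T f n x} from
      hN.trans_le (birkhoffSum_le_birkhoffMax hn x)) f).symm
  refine ge_of_tendsto' hlim fun n => ?_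
  rw [integral_indicator (hS n)]
  exact setIntegral_birkhoffMax_pos_nonneg hT hfm hf n

/-- The set where the sums are unbounded above is mapped into itself by `T`, so it is null or
conull; in the latter case the maximal inequality would make the integral nonnegative. -/
theorem ae_bddAbove_birkhoffSum [IsFiniteMeasure μ] (hT : Ergodic T μ) (hfm : Measurable f)
    (hf : Integrable f μ) (hneg : ∫ x, f x ∂μ < 0) :
    ∀ᵐ x ∂μ, BddAbove (Set.range fun n => birkhoffSum T f n x) := by
  set A : Set α := ⋂ B : ℕ, ⋃ n : ℕ, {x | (B : ℝ) < birkhoffSum T f n x} with hA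
  have hmem : ∀ x, x ∈ A ↔ ∀ B : ℕ, ∃ n, (B : ℝ) < birkhoffSum T f n x := fun x => by simp [hA]
  have hAm : MeasurableSet A := MeasurableSet.iInter fun B => MeasurableSet.iUnion fun n =>
    measurableSet_lt measurable_const (measurable_birkhoffSum hT.measurable hfm n)
  have hsub : A ⊆ T ⁻¹' A := by
    intro x hx
    rw [Set.mem_preimage, hmem]
    intro B
    obtain ⟨C, hC⟩ := exists_nat_gt ((B : ℝ) + |f x|)
    obtain ⟨n, hn⟩ := (hmem x).1 hx C
    cases n with
    | zero =>
      rw [birkhoffSum_zero] at hn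
      exact absurd hn (not_lt.2 (Nat.cast_nonneg C))
    | succ n =>
      refine ⟨n, ?_⟩
      rw [birkhoffSum_succ'] at hn
      have := le_abs_self (f x)
      linarith
  rcases hT.ae_empty_or_univ_of_ae_le_preimage hAm.nullMeasurableSet
    (LE.le.eventuallyLE hsub) with h | h
  · filter_upwards [ae_eq_empty.1 h |> measure_eq_zero_iff_ae_notMem.1] with x hx
    rw [hmem] at hx
    push Not at hx
    obtain ⟨B, hB⟩ := hx
    exact ⟨B, by rintro _ ⟨n, rfl⟩; exact hB n⟩
  · refine absurd (integral_nonneg_of_birkhoffSum_pos hT.toMeasurePreserving hfm hf ?_)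
      (not_le.2 hneg)
    filter_upwards [mem_ae_iff.2 (ae_eq_univ.1 h)] with x hx
    simpa using (hmem x).1 hx 0

/-- For a rational `q` above the mean, the sums of `f - q` are bounded above, so the averages of `f`
are at most `q + B / n`. -/
theorem ae_eventually_birkhoffSum_lt [IsProbabilityMeasure μ] (hT : Ergodic T μ)
    (hfm : Measurable f) (hf : Integrable f μ) :
    ∀ᵐ x ∂μ, ∀ c > ∫ x, f x ∂μ, ∀ᶠ n : ℕ in atTop, birkhoffSum T f n x / n < c := by
  have h : ∀ᵐ x ∂μ, ∀ q : ℚ, ∫ x, f x ∂μ < q →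
      BddAbove (Set.range fun n => birkhoffSum T (fun y => f y - q) n x) := by
    rw [ae_all_iff]
    intro q
    by_cases hq : ∫ x, f x ∂μ < q
    · have := ae_bddAbove_birkhoffSum (f := fun y => f y - q) hT (hfm.sub_const _)
        (hf.sub (integrable_const _)) (by
          rw [integral_sub hf (integrable_const _)]; simpa using hq)
      filter_upwards [this] with x hx _ using hx
    · exact Eventually.of_forall fun x h => absurd h hq
  filter_upwards [h] with x hx c hc
  obtain ⟨q, hq1, hq2⟩ := exists_rat_btwn hc
  obtain ⟨B, hB⟩ := hx q hq1
  have hlim : Tendsto (fun n : ℕ => B / (n : ℝ)) atTop (𝓝 0) :=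
    tendsto_const_div_atTop_nhds_zero_nat B
  filter_upwards [hlim.eventually_lt_const (sub_pos.2 hq2), eventually_gt_atTop 0] with n hn hn0
  have h1 : birkhoffSum T (fun y => f y - q) n x ≤ B := hB ⟨n, rfl⟩
  have h2 : birkhoffSum T (fun y => f y - q) n x = birkhoffSum T f n x - n * q := by
    simp [birkhoffSum, Finset.sum_sub_distrib]
  have hn' : (0 : ℝ) < n := Nat.cast_pos.2 hn0
  rw [h2] at h1
  rw [div_lt_iff₀ hn'] at hn ⊢
  linarith

/-- Birkhoff's ergodic theorem for an ergodic transformation. -/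
theorem ae_tendsto_birkhoffSum_div [IsProbabilityMeasure μ] (hT : Ergodic T μ)
    (hfm : Measurable f) (hf : Integrable f μ) :
    ∀ᵐ x ∂μ, Tendsto (fun n : ℕ => birkhoffSum T f n x / n) atTop (𝓝 (∫ x, f x ∂μ)) := by
  filter_upwards [ae_eventually_birkhoffSum_lt hT hfm hf,
    ae_eventually_birkhoffSum_lt (f := fun y => - f y) hT hfm.neg hf.neg] with x h1 h2
  refine tendsto_order.2 ⟨fun c hc => ?_, fun c hc => h1 c hc⟩
  filter_upwards [h2 (-c) (by rw [integral_neg]; linarith)] with n hn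
  have : birkhoffSum T (fun y => - f y) n x = - birkhoffSum T f n x := by
    simp [birkhoffSum]
  rw [this, neg_div] at hn
  linarith

open Classical in
/-- The frequency of the visits to a set converges to its measure. -/
theorem ae_tendsto_card_visits_div [IsProbabilityMeasure μ] (hT : Ergodic T μ) {B : Set α}
    (hB : MeasurableSet B) :
    ∀ᵐ x ∂μ, Tendsto
      (fun n : ℕ => (((Finset.range n).filter fun j => T^[j] x ∈ B).card : ℝ) / n) atTop
      (𝓝 (μ.real B)) := by
  have h := ae_tendsto_birkhoffSum_div (f := B.indicator fun _ => (1 : ℝ)) hT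
    (measurable_const.indicator hB) ((integrable_const _).indicator hB)
  rw [integral_indicator_const _ hB, smul_eq_mul, mul_one] at h
  filter_upwards [h] with x hx
  refine hx.congr fun n => ?_
  simp [birkhoffSum, Set.indicator_apply]

end Ergodic

/-! ### The limit measure of the points of the persistence diagrams -/

/-- The supremum of an increasing sequence of measures. -/
def monotoneSup {α : Type*} [MeasurableSpace α] (m : ℕ → Measure α) (hm : Monotone m) :
    Measure α :=
  Measure.ofMeasurable (fun B _ => ⨆ k, m k B) (by simp) fun B hB hd => by
    simp only [measure_iUnion hd hB]
    -- Countable additivity is monotone convergence for the counting measure.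
    have h := lintegral_iSup (μ := Measure.count) (f := fun k (i : ℕ) => m k (B i))
      (fun k => measurable_of_countable _) fun k l hkl i => hm hkl (B i)
    simp only [lintegral_count] at h
    exact h.symm

theorem monotoneSup_apply {α : Type*} [MeasurableSpace α] {m : ℕ → Measure α} (hm : Monotone m)
    {B : Set α} (hB : MeasurableSet B) : monotoneSup m hm B = ⨆ k, m k B :=
  Measure.ofMeasurable_apply B hB

/-! ### Enclosure by smaller terms has probability close to one. -/

/-- The distribution function has no jumps, so it cannot leave zero by a jump of size ε. Its zero
set is null, being covered by null rational rays and at most one further point; if all positive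
values exceeded ε, continuity from above would give this set measure at least ε. -/
theorem exists_measure_Iio_pos_le (μ : Measure ℝ) [IsProbabilityMeasure μ]
    (hatom : ∀ a, μ {a} = 0) {ε : ENNReal} (hε : 0 < ε) :
    ∃ q : ℝ, 0 < μ (Set.Iio q) ∧ μ (Set.Iio q) ≤ ε := by
  by_contra! hcon
  set S : Set ℝ := {t | μ (Set.Iio t) = 0} with hS
  have hnull : μ S = 0 := by
    have h1 : S ⊆ (⋃ q : {q : ℚ // (q : ℝ) ∈ S}, Set.Iio ((q : ℚ) : ℝ)) ∪
        (S \ ⋃ q : {q : ℚ // (q : ℝ) ∈ S}, Set.Iio ((q : ℚ) : ℝ)) := by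
      rw [Set.union_sdiff_self]; exact Set.subset_union_right
    refine measure_mono_null h1 (measure_union_null (measure_iUnion_null fun q => q.2) ?_)
    have h2 : (S \ ⋃ q : {q : ℚ // (q : ℝ) ∈ S}, Set.Iio ((q : ℚ) : ℝ)).Subsingleton := by
      have key : ∀ s t : ℝ, s < t → t ∈ S →
          s ∈ ⋃ q : {q : ℚ // (q : ℝ) ∈ S}, Set.Iio ((q : ℚ) : ℝ) := by
        intro s t hst ht
        obtain ⟨q, hq1, hq2⟩ := exists_rat_btwn hst
        have hq : (q : ℝ) ∈ S := measure_mono_null (Set.Iio_subset_Iio hq2.le) ht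
        exact Set.mem_iUnion.2 ⟨⟨q, hq⟩, hq1⟩
      intro s hs t ht
      rcases lt_trichotomy s t with h | h | h
      · exact absurd (key s t h ht.1) hs.2
      · exact h
      · exact absurd (key t s h hs.1) ht.2
    rcases h2.eq_empty_or_singleton with h | ⟨a, h⟩
    · rw [h]; exact measure_empty
    · rw [h]; exact hatom a
  have hsub : (⋂ q : {q : ℚ // (q : ℝ) ∉ S}, Set.Iio ((q : ℚ) : ℝ)) ⊆ S := by
    intro t ht
    have h1 : Set.Iio t = ⋃ q : {q : ℚ // (q : ℝ) < t}, Set.Iio ((q : ℚ) : ℝ) := by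
      ext s
      simp only [Set.mem_Iio, Set.mem_iUnion]
      constructor
      · intro hs
        obtain ⟨q, hq1, hq2⟩ := exists_rat_btwn hs
        exact ⟨⟨q, hq2⟩, hq1⟩
      · rintro ⟨⟨q, hq⟩, hs⟩
        exact lt_trans hs hq
    change μ (Set.Iio t) = 0
    rw [h1]
    refine measure_iUnion_null fun ⟨q, hq⟩ => ?_
    by_contra hqS
    have h2 : t < q := Set.mem_iInter.1 ht ⟨q, hqS⟩
    exact lt_asymm h2 hq
  have hI := Directed.measure_iInter (μ := μ)
    (s := fun q : {q : ℚ // (q : ℝ) ∉ S} => Set.Iio ((q : ℚ) : ℝ))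
    (fun q => measurableSet_Iio.nullMeasurableSet) (fun q r => by
      rcases le_total (q : ℚ) (r : ℚ) with h | h
      · exact ⟨q, subset_rfl, Set.Iio_subset_Iio (by exact_mod_cast h)⟩
      · exact ⟨r, Set.Iio_subset_Iio (by exact_mod_cast h), subset_rfl⟩)
    (by
      by_contra hemp
      have : IsEmpty {q : ℚ // (q : ℝ) ∉ S} := ⟨fun q => hemp ⟨q, measure_ne_top _ _⟩⟩
      rw [Set.iInter_of_empty] at hsub
      have := measure_mono_null hsub hnull
      simp at this)
  rw [measure_mono_null hsub hnull] at hI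
  have : ε ≤ ⨅ q : {q : ℚ // (q : ℝ) ∉ S}, μ (Set.Iio ((q : ℚ) : ℝ)) :=
    le_iInf fun q => (hcon q (pos_iff_ne_zero.2 q.2)).le
  rw [← hI] at this
  exact absurd this (not_le.2 hε)

theorem measure_preimage_iterate_shift {Q : Measure (ℕ → ℝ)} (hQ : MeasurePreserving shift Q Q) (m : ℕ)
    {B : Set (ℕ → ℝ)} (hB : MeasurableSet B) : Q {x | shift^[m] x ∈ B} = Q B :=
  (hQ.iterate m).measure_preimage hB.nullMeasurableSet

section Law

variable {Q : Measure (ℕ → ℝ)} [IsProbabilityMeasure Q]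

/-- The limiting event, that no term is below `q`, is preserved by the shift; by ergodicity it is
null, since it excludes `x 0 < q`. -/
theorem tendsto_measure_forall_ge (hQ : Ergodic shift Q) {q : ℝ} (hq : 0 < Q {x | x 0 < q}) :
    Tendsto (fun k => Q {x | ∀ j < k, q ≤ x j}) atTop (𝓝 0) := by
  have hm : ∀ k, MeasurableSet {x : ℕ → ℝ | ∀ j < k, q ≤ x j} := fun k => by
    have : {x : ℕ → ℝ | ∀ j < k, q ≤ x j} = ⋂ j : Set.Iio k, {x | q ≤ x j} := by ext x; simp
    rw [this]
    exact MeasurableSet.iInter fun j => measurableSet_le measurable_const (measurable_pi_apply _)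
  have hlim := tendsto_measure_iInter_atTop (μ := Q) (s := fun k => {x : ℕ → ℝ | ∀ j < k, q ≤ x j})
    (fun k => (hm k).nullMeasurableSet) (fun k l hkl x hx j hj => hx j (hj.trans_le hkl))
    ⟨0, measure_ne_top _ _⟩
  set C : Set (ℕ → ℝ) := ⋂ k, {x : ℕ → ℝ | ∀ j < k, q ≤ x j} with hC
  have hmem : ∀ x, x ∈ C ↔ ∀ j, q ≤ x j := fun x => by
    rw [hC, Set.mem_iInter]
    exact ⟨fun h j => h (j + 1) j (Nat.lt_succ_self j), fun h k j _ => h j⟩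
  have hsub : C ⊆ shift ⁻¹' C := fun x hx => (hmem _).2 fun j => (hmem x).1 hx (j + 1)
  have h0 : Q C = 0 := by
    rcases hQ.ae_empty_or_univ_of_ae_le_preimage
      (MeasurableSet.iInter hm).nullMeasurableSet (LE.le.eventuallyLE hsub) with h | h
    · exact ae_eq_empty.1 h
    · refine absurd (measure_mono_null ?_ (ae_eq_univ.1 h)) hq.ne'
      intro x hx hxC
      exact absurd ((hmem x).1 hxC 0) (not_le.2 hx)
  rw [h0] at hlim
  exact hlim

theorem tendsto_measure_compl_enclosed (hQ : Ergodic shift Q) (hatom : ∀ a, Q {x | x 0 = a} = 0) :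
    Tendsto (fun k => Q (enclosed k)ᶜ) atTop (𝓝 0) := by
  have h0 : Measurable fun x : ℕ → ℝ => x 0 := measurable_pi_apply 0
  have : IsProbabilityMeasure (Q.map fun x => x 0) := Measure.isProbabilityMeasure_map h0.aemeasurable
  rw [ENNReal.tendsto_nhds_zero]
  intro ε hε
  have hε3 : 0 < ε / 3 := ENNReal.div_pos hε.ne' (by simp)
  obtain ⟨q, hq1, hq2⟩ := exists_measure_Iio_pos_le (Q.map fun x => x 0)
    (fun a => by rw [Measure.map_apply h0 (measurableSet_singleton a)]; exact hatom a) hε3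
  rw [Measure.map_apply h0 measurableSet_Iio] at hq1 hq2
  have hm : ∀ k, MeasurableSet {x : ℕ → ℝ | ∀ j < k, q ≤ x j} := fun k => by
    have : {x : ℕ → ℝ | ∀ j < k, q ≤ x j} = ⋂ j : Set.Iio k, {x | q ≤ x j} := by ext x; simp
    rw [this]
    exact MeasurableSet.iInter fun j => measurableSet_le measurable_const (measurable_pi_apply _)
  filter_upwards [ENNReal.tendsto_nhds_zero.1 (tendsto_measure_forall_ge hQ hq1) (ε / 3) hε3]
    with k hk
  -- Three bad events, each of probability at most ε / 3: the term `k` is below `q`, or no term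
  -- below `q` occurs among the `k` terms before it, or among the `k` terms from it on.
  have hsub : (enclosed k)ᶜ ⊆ {x | shift^[k] x ∈ {x : ℕ → ℝ | x 0 < q}} ∪
      ({x | ∀ j < k, q ≤ x j} ∪ {x | shift^[k] x ∈ {x : ℕ → ℝ | ∀ j < k, q ≤ x j}}) := by
    intro x hx
    by_cases hxq : x k < q
    · left
      change shift^[k] x 0 < q
      rwa [iterate_shift, zero_add]
    · right
      rw [not_lt] at hxq
      by_cases h1 : ∃ j < k, x j < x k
      · right
        intro j hj
        rw [iterate_shift]
        refine hxq.trans (not_lt.1 fun h => hx ⟨h1, j, hj.le, ?_⟩)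
        rwa [add_comm k j]
      · left
        push Not at h1
        exact fun j hj => hxq.trans (h1 j hj)
  calc Q (enclosed k)ᶜ ≤ _ := measure_mono hsub
    _ ≤ ε / 3 + (ε / 3 + ε / 3) := by
      refine (measure_union_le _ _).trans (add_le_add ?_ ((measure_union_le _ _).trans
        (add_le_add hk ?_)))
      · rw [measure_preimage_iterate_shift hQ.toMeasurePreserving _
          (measurableSet_lt h0 measurable_const)]
        exact hq2
      · rw [measure_preimage_iterate_shift hQ.toMeasurePreserving _ (hm k)]
        exact hk
    _ = ε := by rw [← add_assoc, ENNReal.add_thirds]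

/-- The law of the birth and the death of the term in the middle of `2 k + 1` terms, when this
term is enclosed by smaller ones. -/
def windowLaw (Q : Measure (ℕ → ℝ)) (k : ℕ) : Measure (EReal × EReal) :=
  (Q.restrict (enclosed k)).map fun x => birthDeath x (2 * k + 1) k

/-- The sequences whose middle term is enclosed and has birth and death in `B`. -/
def windowSet (k : ℕ) (B : Set (EReal × EReal)) : Set (ℕ → ℝ) :=
  {x | x ∈ enclosed k ∧ birthDeath x (2 * k + 1) k ∈ B}

theorem windowLaw_apply (Q : Measure (ℕ → ℝ)) (k : ℕ) {B : Set (EReal × EReal)}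
    (hB : MeasurableSet B) :
    windowLaw Q k B = Q (windowSet k B) := by
  rw [windowLaw, Measure.map_apply (measurable_birthDeath _ _) hB,
    Measure.restrict_apply (measurable_birthDeath _ _ hB), Set.inter_comm]
  rfl

theorem measurableSet_window (k : ℕ) {B : Set (EReal × EReal)} (hB : MeasurableSet B) :
    MeasurableSet (windowSet k B) :=
  (measurableSet_enclosed k).inter (measurable_birthDeath _ _ hB)

/-- By stationarity the smaller window may be centred inside the larger one; if it encloses its
centre, both give the same birth and death. -/
theorem monotone_windowLaw {Q : Measure (ℕ → ℝ)} (hQ : MeasurePreserving shift Q Q) : Monotone (windowLaw Q) := by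
  intro k l hkl
  refine Measure.le_iff.2 fun B hB => ?_
  rw [windowLaw_apply Q k hB, windowLaw_apply Q l hB,
    ← measure_preimage_iterate_shift hQ (l - k) (measurableSet_window k hB)]
  refine measure_mono fun x hx => ⟨?_, ?_⟩
  · obtain ⟨⟨⟨a, ha, hxa⟩, b, hb, hxb⟩, -⟩ := hx
    rw [iterate_shift, iterate_shift] at hxa hxb
    refine ⟨⟨a + (l - k), by omega, ?_⟩, b, by omega, ?_⟩
    · rwa [show k + (l - k) = l by omega] at hxa
    · rwa [show k + (l - k) = l by omega, show k + b + (l - k) = l + b by omega] at hxb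
  · rw [birthDeath_eq_of_enclosed hkl (by omega) hx.1]
    exact hx.2

/-- The limit law of the birth and the death of a term. -/
def limitLaw (hQ : MeasurePreserving shift Q Q) : Measure (EReal × EReal) :=
  monotoneSup (windowLaw Q) (monotone_windowLaw hQ)

/-- No mass escapes: the mass of `windowLaw Q k` is the probability of enclosure, which tends to
one. -/
theorem isProbabilityMeasure_limitLaw (hQ : Ergodic shift Q)
    (hatom : ∀ a, Q {x | x 0 = a} = 0) :
    IsProbabilityMeasure (limitLaw hQ.toMeasurePreserving) := by
  constructor
  rw [limitLaw, monotoneSup_apply _ MeasurableSet.univ]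
  have h1 : ∀ k, windowLaw Q k Set.univ = 1 - Q (enclosed k)ᶜ := fun k => by
    rw [windowLaw_apply Q k MeasurableSet.univ, ← prob_compl_eq_one_sub
      (measurableSet_enclosed k).compl, compl_compl]
    simp only [windowSet, Set.mem_univ, and_true]
    rfl
  have h2 : Tendsto (fun k => windowLaw Q k Set.univ) atTop (𝓝 1) := by
    simp only [h1]
    have := ENNReal.Tendsto.sub (tendsto_const_nhds (x := (1 : ENNReal)))
      (tendsto_measure_compl_enclosed hQ hatom) (Or.inl ENNReal.one_ne_top)
    rwa [tsub_zero] at this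
  exact tendsto_nhds_unique (tendsto_atTop_iSup fun k l hkl =>
    monotone_windowLaw hQ.toMeasurePreserving hkl Set.univ) h2

open Classical in
/-- The number of terms among the first `n` with birth and death in `B`. -/
def pointCount (x : ℕ → ℝ) (n : ℕ) (B : Set (EReal × EReal)) : ℕ :=
  ((Finset.range n).filter fun i => birthDeath x n i ∈ B).card

theorem pointCount_add_compl (x : ℕ → ℝ) (n : ℕ) (B : Set (EReal × EReal)) :
    pointCount x n B + pointCount x n Bᶜ = n := by
  classical
  have h := Finset.card_filter_add_card_filter_not (s := Finset.range n)
    (fun i => birthDeath x n i ∈ B)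
  rw [Finset.card_range] at h
  rw [pointCount, pointCount]
  convert h using 2
  congr 1
  ext i
  simp

open Classical in
-- The window that starts at `j` has the term `j + k` as its centre. The error `2 * k` accounts for
-- the last starting points, whose windows leave the first `n` terms.
theorem card_window_le (x : ℕ → ℝ) (k n : ℕ) (B : Set (EReal × EReal)) :
    ((Finset.range n).filter fun j => shift^[j] x ∈
      windowSet k B).card ≤
    pointCount x n B + 2 * k := by
  have h1 : ((Finset.range n).filter fun j => shift^[j] x ∈
      windowSet k B) ⊆
      (((Finset.range n).filter fun i => birthDeath x n i ∈ B).image fun i => i - k) ∪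
        Finset.Ico (n - 2 * k) n := by
    intro j hj
    obtain ⟨hjn, hj1, hj2⟩ := Finset.mem_filter.1 hj
    rw [Finset.mem_range] at hjn
    rw [Finset.mem_union, Finset.mem_Ico]
    by_cases h : n - 2 * k ≤ j
    · exact Or.inr ⟨h, hjn⟩
    · left
      have hjk : j + k - k = j := by omega
      refine Finset.mem_image.2 ⟨j + k, Finset.mem_filter.2 ⟨Finset.mem_range.2 (by omega), ?_⟩,
        hjk⟩
      rw [birthDeath_eq_of_enclosed (k := k) (by omega) (by omega) (by rwa [hjk]), hjk]
      exact hj2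
  refine (Finset.card_le_card h1).trans ((Finset.card_union_le _ _).trans
    (add_le_add Finset.card_image_le ?_))
  rw [Nat.card_Ico]
  omega

theorem ae_eventually_lt_card_div (hQ : Ergodic shift Q) {B : Set (EReal × EReal)}
    (hB : MeasurableSet B) :
    ∀ᵐ x ∂Q, ∀ c : ℝ, (c < (limitLaw hQ.toMeasurePreserving).real B) → ∀ᶠ n : ℕ in atTop,
      c < (pointCount x n B : ℝ) / n := by
  have h : ∀ᵐ x ∂Q, ∀ k : ℕ, _ := ae_all_iff.2 fun k : ℕ =>
    ae_tendsto_card_visits_div hQ (measurableSet_window k hB)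
  filter_upwards [h] with x hx c hc
  rcases lt_or_ge c 0 with hc0 | hc0
  · exact Eventually.of_forall fun n => hc0.trans_le (by positivity)
  classical
  obtain ⟨k, hk⟩ : ∃ k, ENNReal.ofReal c < windowLaw Q k B := by
    have h1 : ENNReal.ofReal c < limitLaw hQ.toMeasurePreserving B :=
      (ENNReal.lt_ofReal_iff_toReal_lt ENNReal.ofReal_ne_top).2 (by
        rwa [ENNReal.toReal_ofReal hc0]) |>.trans_le ENNReal.ofReal_toReal_le
    rw [limitLaw, monotoneSup_apply _ hB] at h1
    exact lt_iSup_iff.1 h1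
  rw [windowLaw_apply Q k hB] at hk
  have hk' : c < Q.real (windowSet k B) :=
    (ENNReal.ofReal_lt_iff_lt_toReal hc0 (measure_ne_top _ _)).1 hk
  have hlim : Tendsto (fun n : ℕ => (((Finset.range n).filter fun j => shift^[j] x ∈
      windowSet k B).card : ℝ) / n -
      (2 * k : ℝ) / n) atTop (𝓝 _) :=
    (hx k).sub (tendsto_const_div_atTop_nhds_zero_nat (2 * k : ℝ))
  rw [sub_zero] at hlim
  filter_upwards [hlim.eventually_const_lt hk'] with n hn
  refine hn.trans_le ?_
  rw [← sub_div]
  refine div_le_div_of_nonneg_right ?_ (Nat.cast_nonneg n)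
  rw [sub_le_iff_le_add]
  exact_mod_cast card_window_le x k n B

/-- The frequency of the points of the diagram in a given set converges almost surely. -/
theorem ae_tendsto_card_div (hQ : Ergodic shift Q) (hatom : ∀ a, Q {x | x 0 = a} = 0)
    {B : Set (EReal × EReal)} (hB : MeasurableSet B) :
    ∀ᵐ x ∂Q, Tendsto
      (fun n : ℕ => (pointCount x n B : ℝ) / n) atTop
      (𝓝 ((limitLaw hQ.toMeasurePreserving).real B)) := by
  have := isProbabilityMeasure_limitLaw hQ hatom
  -- The lower bound for the complement is the upper bound for `B`: the counts add up to `n` and the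
  -- limit masses to one.
  filter_upwards [ae_eventually_lt_card_div hQ hB, ae_eventually_lt_card_div hQ hB.compl]
    with x h1 h2
  refine tendsto_order.2 ⟨h1, fun c hc => ?_⟩
  have h3 : 1 - c < (limitLaw hQ.toMeasurePreserving).real Bᶜ := by
    rw [probReal_compl_eq_one_sub hB]; linarith
  filter_upwards [h2 _ h3, eventually_gt_atTop 0] with n hn hn0
  have hn' : (0 : ℝ) < n := Nat.cast_pos.2 hn0
  have hcard : (pointCount x n B : ℝ) + pointCount x n Bᶜ = n := by
    exact_mod_cast pointCount_add_compl x n B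
  rw [lt_div_iff₀ hn'] at hn
  rw [div_lt_iff₀ hn']
  linarith

/-! ### Positive frequency of the points of the diagram. -/

/-- The bounded function arctan makes the terms integrable; by stationarity the increment has mean
zero, so it cannot be almost surely positive. -/
theorem not_ae_lt_shift (hQ : MeasurePreserving shift Q Q) : ¬ ∀ᵐ x ∂Q, x 0 < x 1 := by
  intro h
  have hint : ∀ i, Integrable (fun x : ℕ → ℝ => Real.arctan (x i)) Q := fun i =>
    Integrable.of_bound (C := Real.pi / 2)
      (Real.measurable_arctan.comp (measurable_pi_apply i)).aestronglyMeasurable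
      (Eventually.of_forall fun x => abs_le.2
        ⟨(Real.neg_pi_div_two_lt_arctan _).le, (Real.arctan_lt_pi_div_two _).le⟩)
  have h1 : ∫ x, Real.arctan (x 1) ∂Q = ∫ x, Real.arctan (x 0) ∂Q := by
    have := integral_map (μ := Q) hQ.measurable.aemeasurable
      (f := fun x : ℕ → ℝ => Real.arctan (x 0))
      (by rw [hQ.map_eq]; exact (hint 0).aestronglyMeasurable)
    rw [hQ.map_eq] at this
    exact this.symm
  have h2 : ∫ x, (Real.arctan (x 1) - Real.arctan (x 0)) ∂Q = 0 := by
    rw [integral_sub (hint 1) (hint 0), h1, sub_self]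
  have h3 := (integral_eq_zero_iff_of_nonneg_ae (by
    filter_upwards [h] with x hx using sub_nonneg.2 (Real.arctan_strictMono hx).le)
    ((hint 1).sub (hint 0))).1 h2
  have h4 : ∀ᵐ x ∂Q, False := by
    filter_upwards [h, h3] with x hx hx'
    have := Real.arctan_strictMono hx
    have hx'' : Real.arctan (x 1) - Real.arctan (x 0) = 0 := hx'
    linarith
  exact IsProbabilityMeasure.ne_zero Q (by simpa using h4)

theorem not_ae_gt_shift (hQ : MeasurePreserving shift Q Q) : ¬ ∀ᵐ x ∂Q, x 1 < x 0 := by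
  intro h
  have hneg : Measurable fun (x : ℕ → ℝ) (i : ℕ) => - x i :=
    measurable_pi_lambda _ fun i => (measurable_pi_apply i).neg
  have : IsProbabilityMeasure (Q.map fun x i => - x i) :=
    Measure.isProbabilityMeasure_map hneg.aemeasurable
  refine not_ae_lt_shift (Q := Q.map fun x i => - x i) ⟨measurable_shift, ?_⟩ ?_
  · rw [Measure.map_map measurable_shift hneg]
    have : shift ∘ (fun (x : ℕ → ℝ) i => - x i) = (fun x i => - x i) ∘ shift := rfl
    rw [this, ← Measure.map_map hneg measurable_shift, hQ.map_eq]
  · rw [ae_map_iff hneg.aemeasurable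
      (measurableSet_lt (measurable_pi_apply 0) (measurable_pi_apply 1))]
    filter_upwards [h] with x hx using neg_lt_neg hx

/-- Local minima have positive probability. -/
theorem measure_localMin_pos (hQ : Ergodic shift Q) (hne : Q {x | x 0 = x 1} = 0) :
    0 < Q {x | x 1 < x 0 ∧ x 1 < x 2} := by
  rw [pos_iff_ne_zero]
  intro h0
  have hA : MeasurableSet {x : ℕ → ℝ | x 0 < x 1} :=
    measurableSet_lt (measurable_pi_apply 0) (measurable_pi_apply 1)
  have hne' : ∀ᵐ x ∂Q, x 0 ≠ x 1 := measure_eq_zero_iff_ae_notMem.1 hne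
  have h0' : ∀ᵐ x ∂Q, ¬ (x 1 < x 0 ∧ x 1 < x 2) := measure_eq_zero_iff_ae_notMem.1 h0
  -- Without local minima an ascent is preceded by an ascent. Ergodicity then makes the first step
  -- almost surely an ascent or almost surely a descent, and stationarity forbids both.
  have hsub : shift ⁻¹' {x | x 0 < x 1} ≤ᵐ[Q] {x | x 0 < x 1} := by
    filter_upwards [hne', h0'] with x h1 h2 h3
    exact lt_of_le_of_ne (not_lt.1 fun h => h2 ⟨h, h3⟩) h1
  rcases hQ.ae_empty_or_univ_of_preimage_ae_le hA.nullMeasurableSet hsub with h | h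
  · refine not_ae_gt_shift hQ.toMeasurePreserving ?_
    filter_upwards [hne', measure_eq_zero_iff_ae_notMem.1 (ae_eq_empty.1 h)] with x h1 h2
    exact lt_of_le_of_ne (not_lt.1 h2) h1.symm
  · exact not_ae_lt_shift hQ.toMeasurePreserving (mem_ae_iff.2 (ae_eq_univ.1 h))

/-- `Δ` as a subset of the plane. -/
def deltaSet : Set (EReal × EReal) := {p | ⊥ < p.1 ∧ p.1 < p.2}

theorem measurableSet_deltaSet : MeasurableSet deltaSet :=
  (measurableSet_lt measurable_const measurable_fst).inter
    (measurableSet_lt measurable_fst measurable_snd)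

theorem limitLaw_deltaSet_ne_zero (hQ : Ergodic shift Q) (hatom : ∀ a, Q {x | x 0 = a} = 0)
    (hne : Q {x | x 0 = x 1} = 0) : limitLaw hQ.toMeasurePreserving deltaSet ≠ 0 := by
  intro h0
  have hL : MeasurableSet {x : ℕ → ℝ | x 1 < x 0 ∧ x 1 < x 2} :=
    (measurableSet_lt (measurable_pi_apply 1) (measurable_pi_apply 0)).inter
      (measurableSet_lt (measurable_pi_apply 1) (measurable_pi_apply 2))
  -- The radius is taken so large that failure of enclosure is less likely than a local minimum. The
  -- minimum then sits at the centre `m + 1`.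
  obtain ⟨m, hm⟩ := (((tendsto_measure_compl_enclosed hQ hatom).comp
    (tendsto_add_atTop_nat 1)).eventually_lt_const (measure_localMin_pos hQ hne)).exists
  rw [limitLaw, monotoneSup_apply _ measurableSet_deltaSet, ENNReal.iSup_eq_zero] at h0
  have h1 := h0 (m + 1)
  rw [windowLaw_apply Q _ measurableSet_deltaSet] at h1
  refine absurd hm (not_lt.2 ?_)
  rw [← measure_preimage_iterate_shift hQ.toMeasurePreserving m hL]
  have hsub : {x | shift^[m] x ∈ {x : ℕ → ℝ | x 1 < x 0 ∧ x 1 < x 2}} ⊆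
      windowSet (m + 1) deltaSet ∪
        (enclosed (m + 1))ᶜ := by
    rintro x ⟨hx1, hx2⟩
    rw [iterate_shift, iterate_shift] at hx1 hx2
    by_cases hx : x ∈ enclosed (m + 1)
    · left
      refine ⟨hx, EReal.bot_lt_coe _, lt_death_of_isolated (by omega) ?_ ?_⟩
      · rwa [add_comm 1 m, zero_add] at hx1
      · rwa [add_comm 1 m, add_comm 2 m] at hx2
    · exact Or.inr hx
  refine (measure_mono hsub).trans ((measure_union_le _ _).trans ?_)
  rw [h1, zero_add]
  rfl

end Law

/-! ### Countable families of sets that determine the convergence -/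

section Portmanteau

variable {α : Type*} [TopologicalSpace α] [SecondCountableTopology α] [MeasurableSpace α]
  [OpensMeasurableSpace α]

/-- Weak convergence follows from the convergence of the measures of the finite unions of basic
open sets. -/
theorem tendsto_integral_of_finite_unions {μ : Measure α} [IsProbabilityMeasure μ]
    {ν : ℕ → Measure α} [∀ n, IsProbabilityMeasure (ν n)]
    (h : ∀ S : Finset (TopologicalSpace.countableBasis α),
      Tendsto (fun n => ν n (⋃ u ∈ S, (u : Set α))) atTop (𝓝 (μ (⋃ u ∈ S, (u : Set α)))))
    (g : α →ᵇ ℝ) : Tendsto (fun n => ∫ a, g a ∂(ν n)) atTop (𝓝 (∫ a, g a ∂μ)) := by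
  have hopen : ∀ G, IsOpen G → μ G ≤ liminf (fun n => ν n G) atTop := by
    intro G hG
    obtain ⟨S, hS, rfl⟩ :=
      (TopologicalSpace.isBasis_countableBasis α).open_eq_sUnion hG
    rcases S.eq_empty_or_nonempty with rfl | hne
    · simp
    obtain ⟨f, hf⟩ := ((TopologicalSpace.countable_countableBasis α).mono hS).exists_eq_range hne
    have hf' : ∀ i, f i ∈ TopologicalSpace.countableBasis α := fun i => hS (hf ▸ ⟨i, rfl⟩)
    have hU : ⋃₀ S = ⋃ i, f i := by rw [hf, Set.sUnion_range]
    -- Continuity from below reduces the portmanteau inequality to finite unions, where convergence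
    -- is assumed.
    rw [hU, measure_iUnion_eq_iSup_accumulate]
    refine iSup_le fun i => ?_
    classical
    have hacc : Set.accumulate f i = ⋃ u ∈ (Finset.range (i + 1)).image
        (fun j => (⟨f j, hf' j⟩ : TopologicalSpace.countableBasis α)), (u : Set α) := by
      ext a
      simp [Set.accumulate_def]
    have h1 := h ((Finset.range (i + 1)).image
      (fun j => (⟨f j, hf' j⟩ : TopologicalSpace.countableBasis α)))
    rw [← hacc] at h1
    rw [← h1.liminf_eq]
    refine liminf_le_liminf (Eventually.of_forall fun n => measure_mono ?_)
    rw [Set.accumulate_def]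
    exact Set.iUnion₂_subset fun j _ => Set.subset_iUnion f j
  have key := tendsto_of_forall_isOpen_le_liminf' (μ := (⟨μ, inferInstance⟩ : ProbabilityMeasure α))
    (μs := fun n => (⟨ν n, inferInstance⟩ : ProbabilityMeasure α)) (L := atTop) hopen
  exact ProbabilityMeasure.tendsto_iff_forall_integral_tendsto.1 key g

end Portmanteau

/-- The open intervals `Ioo c b` decrease to the empty set as `b` tends to `c`. Leaving out `c`
matters, since `c` may be an atom. -/
theorem exists_right_neighborhood (κ : Measure EReal) [IsFiniteMeasure κ] {ε : ℝ} (hε : 0 < ε)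
    (c : EReal) : ∃ b, ∃ R ∈ 𝓝 c, ∀ l ∈ R, c < l → l < b ∧ κ.real (Set.Ioo c b) < ε := by
  rcases eq_or_ne c ⊤ with rfl | hc
  · exact ⟨⊤, Set.univ, univ_mem, fun l _ hl => absurd hl not_top_lt⟩
  obtain ⟨u, hu, hmem, hlim⟩ := exists_seq_strictAnti_tendsto' (lt_top_iff_ne_top.2 hc)
  have h := tendsto_measure_iInter_atTop (μ := κ) (s := fun n => Set.Ioo c (u n))
    (fun n => measurableSet_Ioo.nullMeasurableSet)
    (fun m n hmn => Set.Ioo_subset_Ioo_right (hu.antitone hmn)) ⟨0, measure_ne_top _ _⟩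
  have hempty : ⋂ n, Set.Ioo c (u n) = ∅ := by
    refine Set.eq_empty_of_forall_notMem fun l hl => ?_
    rw [Set.mem_iInter] at hl
    exact absurd (ge_of_tendsto' hlim fun n => (hl n).2.le) (not_le.2 (hl 0).1)
  rw [hempty, measure_empty] at h
  have h' := (ENNReal.tendsto_toReal ENNReal.zero_ne_top).comp h
  obtain ⟨n, hn⟩ := (h'.eventually_lt_const (by simpa using hε)).exists
  exact ⟨u n, Set.Iio (u n), Iio_mem_nhds (hmem n).1, fun l hl _ => ⟨hl, hn⟩⟩

theorem exists_left_neighborhood (κ : Measure EReal) [IsFiniteMeasure κ] {ε : ℝ} (hε : 0 < ε)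
    (c : EReal) : ∃ a, ∃ R ∈ 𝓝 c, ∀ l ∈ R, l < c → a < l ∧ κ.real (Set.Ioo a c) < ε := by
  rcases eq_or_ne c ⊥ with rfl | hc
  · exact ⟨⊥, Set.univ, univ_mem, fun l _ hl => absurd hl not_lt_bot⟩
  obtain ⟨u, hu, hmem, hlim⟩ := exists_seq_strictMono_tendsto' (bot_lt_iff_ne_bot.2 hc)
  have h := tendsto_measure_iInter_atTop (μ := κ) (s := fun n => Set.Ioo (u n) c)
    (fun n => measurableSet_Ioo.nullMeasurableSet)
    (fun m n hmn => Set.Ioo_subset_Ioo_left (hu.monotone hmn)) ⟨0, measure_ne_top _ _⟩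
  have hempty : ⋂ n, Set.Ioo (u n) c = ∅ := by
    refine Set.eq_empty_of_forall_notMem fun l hl => ?_
    rw [Set.mem_iInter] at hl
    exact absurd (le_of_tendsto' hlim fun n => (hl n).1.le) (not_le.2 (hl 0).2)
  rw [hempty, measure_empty] at h
  have h' := (ENNReal.tendsto_toReal ENNReal.zero_ne_top).comp h
  obtain ⟨n, hn⟩ := (h'.eventually_lt_const (by simpa using hε)).exists
  exact ⟨u n, Set.Ioi (u n), Ioi_mem_nhds (hmem n).2, fun l hl _ => ⟨hl, hn⟩⟩

/-- The extended line is cut by finitely many points into intervals of small measure. -/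
theorem exists_finite_grid (κ : Measure EReal) [IsFiniteMeasure κ] {ε : ℝ} (hε : 0 < ε) :
    ∃ S : Set EReal, S.Finite ∧
      ∀ l, l ∈ S ∨ ∃ a ∈ S, ∃ b ∈ S, a < l ∧ l < b ∧ κ.real (Set.Ioo a b) < ε := by
  have key : ∃ S : Set EReal, S.Finite ∧ ∀ l ∈ (Set.univ : Set EReal),
      l ∈ S ∨ ∃ a ∈ S, ∃ b ∈ S, a < l ∧ l < b ∧ κ.real (Set.Ioo a b) < ε := by
    -- Compactness of the extended line: near `c` the grid `{a, b, c}` suffices, with `c` itself a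
    -- grid point so that its atom lies in no gap.
    refine isCompact_univ.induction_on (p := fun R => ∃ S : Set EReal, S.Finite ∧ ∀ l ∈ R,
      l ∈ S ∨ ∃ a ∈ S, ∃ b ∈ S, a < l ∧ l < b ∧ κ.real (Set.Ioo a b) < ε)
      ⟨∅, Set.finite_empty, fun l hl => hl.elim⟩ ?_ ?_ ?_
    · rintro R R' hRR' ⟨S, hS, h⟩
      exact ⟨S, hS, fun l hl => h l (hRR' hl)⟩
    · rintro R R' ⟨S, hS, h⟩ ⟨S', hS', h'⟩
      refine ⟨S ∪ S', hS.union hS', fun l hl => ?_⟩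
      rcases hl with hl | hl
      · rcases h l hl with h | ⟨a, ha, b, hb, h⟩
        exacts [Or.inl (Or.inl h), Or.inr ⟨a, Or.inl ha, b, Or.inl hb, h⟩]
      · rcases h' l hl with h | ⟨a, ha, b, hb, h⟩
        exacts [Or.inl (Or.inr h), Or.inr ⟨a, Or.inr ha, b, Or.inr hb, h⟩]
    · intro c _
      obtain ⟨b, R, hR, h⟩ := exists_right_neighborhood κ hε c
      obtain ⟨a, R', hR', h'⟩ := exists_left_neighborhood κ hε c
      refine ⟨R ∩ R', mem_nhdsWithin_of_mem_nhds (inter_mem hR hR'), {a, b, c}, by simp,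
        fun l hl => ?_⟩
      rcases lt_trichotomy l c with hlc | rfl | hlc
      · have h1 := h' l hl.2 hlc
        exact Or.inr ⟨a, by simp, c, by simp, h1.1, hlc, h1.2⟩
      · exact Or.inl (by simp)
      · have h1 := h l hl.1 hlc
        exact Or.inr ⟨c, by simp, b, by simp, hlc, h1.1, h1.2⟩
  obtain ⟨S, hS, h⟩ := key
  exact ⟨S, hS, fun l => h l trivial⟩

/-- For `a < l < b` the tail at `l` lies between those of `Ici b` and `Ioi a`, for both measures.
One ε comes from the convergence at grid points, the other from the mass of the gap; both kinds of
rays are needed because of atoms. -/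
theorem eventually_forall_abs_tail_sub_le {κ : Measure EReal} [IsFiniteMeasure κ] {ε : ℝ}
    (hε : 0 < ε) {S : Set EReal} (hS : S.Finite)
    (hgrid : ∀ l, l ∈ S ∨ ∃ a ∈ S, ∃ b ∈ S, a < l ∧ l < b ∧ κ.real (Set.Ioo a b) < ε)
    {η : ℕ → Measure EReal} [∀ n, IsFiniteMeasure (η n)]
    (h1 : ∀ s ∈ S, Tendsto (fun n => (η n).real (Set.Ioi s)) atTop (𝓝 (κ.real (Set.Ioi s))))
    (h2 : ∀ s ∈ S, Tendsto (fun n => (η n).real (Set.Ici s)) atTop (𝓝 (κ.real (Set.Ici s)))) :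
    ∀ᶠ n in atTop, ∀ l, |(η n).real (Set.Ioi l) - κ.real (Set.Ioi l)| ≤ 2 * ε := by
  have e1 : ∀ᶠ n in atTop, ∀ s ∈ S, |(η n).real (Set.Ioi s) - κ.real (Set.Ioi s)| < ε :=
    (eventually_all_finite hS).2 fun s hs => by
      simpa [Real.dist_eq] using (h1 s hs).eventually (Metric.ball_mem_nhds _ hε)
  have e2 : ∀ᶠ n in atTop, ∀ s ∈ S, |(η n).real (Set.Ici s) - κ.real (Set.Ici s)| < ε :=
    (eventually_all_finite hS).2 fun s hs => by
      simpa [Real.dist_eq] using (h2 s hs).eventually (Metric.ball_mem_nhds _ hε)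
  filter_upwards [e1, e2] with n hn1 hn2 l
  rcases hgrid l with hl | ⟨a, ha, b, hb, hal, hlb, hab⟩
  · linarith [hn1 l hl]
  · have ha' := abs_lt.1 (hn1 a ha)
    have hb' := abs_lt.1 (hn2 b hb)
    have i1 : (η n).real (Set.Ioi l) ≤ (η n).real (Set.Ioi a) :=
      measureReal_mono (Set.Ioi_subset_Ioi hal.le)
    have i2 : (η n).real (Set.Ici b) ≤ (η n).real (Set.Ioi l) :=
      measureReal_mono fun x hx => hlb.trans_le hx
    have i3 : κ.real (Set.Ioi l) ≤ κ.real (Set.Ioi a) :=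
      measureReal_mono (Set.Ioi_subset_Ioi hal.le)
    have i4 : κ.real (Set.Ici b) ≤ κ.real (Set.Ioi l) :=
      measureReal_mono fun x hx => hlb.trans_le hx
    have i5 : κ.real (Set.Ioi a) ≤ κ.real (Set.Ioo a b) + κ.real (Set.Ici b) := by
      rw [← Set.Ioo_union_Ici_eq_Ioi (hal.trans hlb)]
      exact measureReal_union_le _ _
    exact abs_le.2 ⟨by linarith, by linarith⟩

/-- The lifetime of a point of `Δ`. -/
def lifetime (p : Delta) : EReal := p.1.2 - p.1.1

theorem measurable_lifetime : Measurable lifetime :=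
  (measurable_snd.comp measurable_subtype_coe).sub (measurable_fst.comp measurable_subtype_coe)

open Classical in
/-- The normalization of a measure, with a dummy value for the zero measure. -/
def normalize {α : Type*} [MeasurableSpace α] (μ₀ μ : Measure α) : Measure α :=
  if μ Set.univ = 0 then μ₀ else (μ Set.univ)⁻¹ • μ

instance {α : Type*} [MeasurableSpace α] (μ₀ μ : Measure α) [IsProbabilityMeasure μ₀]
    [IsFiniteMeasure μ] : IsProbabilityMeasure (normalize μ₀ μ) := by
  unfold normalize
  split_ifs with h
  · infer_instance
  · constructor
    rw [Measure.smul_apply, smul_eq_mul, ENNReal.inv_mul_cancel h (measure_ne_top _ _)]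

theorem normalize_real {α : Type*} [MeasurableSpace α] (μ₀ : Measure α) {μ : Measure α}
    (h : μ Set.univ ≠ 0) (B : Set α) :
    (normalize μ₀ μ).real B = μ.real B / μ.real Set.univ := by
  rw [normalize, if_neg h, measureReal_ennreal_smul_apply, ENNReal.toReal_inv, div_eq_inv_mul]
  rfl

theorem integral_normalize {α : Type*} [MeasurableSpace α] (μ₀ : Measure α) {μ : Measure α}
    (h : μ Set.univ ≠ 0) (g : α → ℝ) :
    ∫ a, g a ∂(normalize μ₀ μ) = (∫ a, g a ∂μ) / μ.real Set.univ := by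
  rw [normalize, if_neg h, integral_smul_measure, ENNReal.toReal_inv, smul_eq_mul, div_eq_inv_mul]
  rfl

/-- For a given limit there are countably many measurable sets such that the convergence of the
normalized measures on these sets implies weak convergence and the uniform convergence of the tails
of the lifetimes. -/
theorem exists_countable_determining (ξ₀ : Measure Delta) [IsProbabilityMeasure ξ₀] :
    ∃ F : Set (Set Delta), F.Countable ∧ (∀ B ∈ F, MeasurableSet B) ∧
      ∀ M : ℕ → Measure Delta, (∀ n, IsFiniteMeasure (M n)) → (∀ᶠ n in atTop, M n Set.univ ≠ 0) →
        (∀ B ∈ F, Tendsto (fun n => (M n).real B / (M n).real Set.univ) atTop (𝓝 (ξ₀.real B))) →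
        (∀ g : Delta →ᵇ ℝ, Tendsto (fun n => (∫ p, g p ∂(M n)) / (M n).real Set.univ) atTop
          (𝓝 (∫ p, g p ∂ξ₀))) ∧
        Tendsto (fun n => ⨆ l : Set.Ici (0 : ℝ),
          |(M n).real (deltaLifetime l) / (M n).real Set.univ - ξ₀.real (deltaLifetime l)|)
          atTop (𝓝 0) := by
  have : SecondCountableTopology Delta := TopologicalSpace.Subtype.secondCountableTopology _
  have : IsProbabilityMeasure (ξ₀.map lifetime) :=
    Measure.isProbabilityMeasure_map measurable_lifetime.aemeasurable
  -- Grids of all the meshes 1 / (m + 1), so that one countable family serves every ε.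
  choose S hSfin hS using fun m : ℕ =>
    exists_finite_grid (ξ₀.map lifetime) (Nat.one_div_pos_of_nat (α := ℝ) (n := m))
  let F1 : Set (Set Delta) := Set.range fun T : Finset (TopologicalSpace.countableBasis Delta) =>
    ⋃ u ∈ T, (u : Set Delta)
  let F2 : Set (Set Delta) := (fun s => lifetime ⁻¹' Set.Ioi s) '' ⋃ m, S m
  let F3 : Set (Set Delta) := (fun s => lifetime ⁻¹' Set.Ici s) '' ⋃ m, S m
  have hSc : (⋃ m, S m).Countable := Set.countable_iUnion fun m => (hSfin m).countable
  have : Countable (TopologicalSpace.countableBasis Delta) :=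
    (TopologicalSpace.countable_countableBasis Delta).to_subtype
  refine ⟨F1 ∪ (F2 ∪ F3), (Set.countable_range _).union ((hSc.image _).union (hSc.image _)),
    ?_, fun M hM hne hF => ?_⟩
  · rintro _ (⟨T, rfl⟩ | ⟨s, -, rfl⟩ | ⟨s, -, rfl⟩)
    · exact (isOpen_biUnion fun u _ => TopologicalSpace.isOpen_of_mem_countableBasis
        u.2).measurableSet
    · exact measurable_lifetime measurableSet_Ioi
    · exact measurable_lifetime measurableSet_Ici
  have hN : ∀ B ∈ F1 ∪ (F2 ∪ F3), Tendsto (fun n => (normalize ξ₀ (M n)).real B) atTop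
      (𝓝 (ξ₀.real B)) := fun B hB => by
    refine (hF B hB).congr' ?_
    filter_upwards [hne] with n hn using (normalize_real ξ₀ hn B).symm
  constructor
  · intro g
    have h := tendsto_integral_of_finite_unions (μ := ξ₀) (ν := fun n => normalize ξ₀ (M n))
      (fun T => (ENNReal.tendsto_toReal_iff (fun n => measure_ne_top _ _)
        (measure_ne_top _ _)).1 (hN _ (Or.inl ⟨T, rfl⟩))) g
    refine h.congr' ?_
    filter_upwards [hne] with n hn using integral_normalize ξ₀ hn g
  · have hη : ∀ n, IsProbabilityMeasure ((normalize ξ₀ (M n)).map lifetime) := fun n =>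
      Measure.isProbabilityMeasure_map measurable_lifetime.aemeasurable
    have hmap : ∀ (μ : Measure Delta) {B : Set EReal}, MeasurableSet B →
        (μ.map lifetime).real B = μ.real (lifetime ⁻¹' B) := fun μ B hB =>
      map_measureReal_apply measurable_lifetime hB
    have hunif : ∀ ε > 0, ∀ᶠ n in atTop, ∀ l : ℝ,
        |(M n).real (deltaLifetime l) / (M n).real Set.univ - ξ₀.real (deltaLifetime l)| ≤ ε := by
      intro ε hε
      obtain ⟨m, hm⟩ := exists_nat_one_div_lt (half_pos hε)
      have h := eventually_forall_abs_tail_sub_le (Nat.one_div_pos_of_nat (α := ℝ) (n := m))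
        (hSfin m) (hS m) (η := fun n => (normalize ξ₀ (M n)).map lifetime)
        (fun s hs => by
          simp only [hmap _ measurableSet_Ioi]
          exact hN _ (Or.inr (Or.inl ⟨s, Set.mem_iUnion.2 ⟨m, hs⟩, rfl⟩)))
        (fun s hs => by
          simp only [hmap _ measurableSet_Ici]
          exact hN _ (Or.inr (Or.inr ⟨s, Set.mem_iUnion.2 ⟨m, hs⟩, rfl⟩)))
      filter_upwards [h, hne] with n hn hn' l
      have h1 := hn (l : EReal)
      rw [hmap _ measurableSet_Ioi, hmap _ measurableSet_Ioi, normalize_real ξ₀ hn'] at h1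
      refine (le_trans h1 ?_ : _)
      linarith
    refine Metric.tendsto_nhds.2 fun ε hε => ?_
    filter_upwards [hunif (ε / 2) (half_pos hε)] with n hn
    rw [Real.dist_eq, sub_zero, abs_of_nonneg (Real.iSup_nonneg fun l => abs_nonneg _)]
    exact (Real.iSup_le (fun l : Set.Ici (0 : ℝ) => hn l) (half_pos hε).le).trans_lt
      (half_lt_self hε)

/-! ### The law of a stationary ergodic sequence -/

section Sequence

variable {Ω : Type*} [MeasurableSpace Ω] {P : Measure Ω} {X : ℕ → Ω → ℝ}

/-- Cylinders determine a law on sequences, and finitely many coordinates lie in an initial segment,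
where stationarity applies with a shift by one. -/
theorem IsStationary.measurePreserving_shift [IsProbabilityMeasure P] (hstat : IsStationary P X)
    (hX : ∀ i, Measurable (X i)) :
    MeasurePreserving shift (P.map fun ω i => X i ω) (P.map fun ω i => X i ω) := by
  have hXm : Measurable fun ω i => X i ω := measurable_pi_lambda _ hX
  refine ⟨measurable_shift, ?_⟩
  have := Measure.isProbabilityMeasure_map (μ := P) hXm.aemeasurable
  have := Measure.isProbabilityMeasure_map (μ := P.map fun ω i => X i ω)
    measurable_shift.aemeasurable
  refine ext_of_generate_finite _ (generateFrom_measurableCylinders (α := fun _ : ℕ => ℝ)).symm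
    isPiSystem_measurableCylinders (fun C hC => ?_) (by simp)
  obtain ⟨s, S, hS, rfl⟩ := (mem_measurableCylinders _).1 hC
  have hCm : MeasurableSet (cylinder s S) :=
    MeasurableSet.cylinder (α := fun _ : ℕ => ℝ) s hS
  rw [Measure.map_map measurable_shift hXm, Measure.map_apply (measurable_shift.comp hXm) hCm,
    Measure.map_apply hXm hCm]
  obtain ⟨d, hd⟩ : ∃ d, ∀ i ∈ s, i < d :=
    ⟨s.sup id + 1, fun i hi => Nat.lt_succ_of_le (Finset.le_sup (f := id) hi)⟩
  have hr : Measurable fun (y : Fin d → ℝ) (i : s) => y ⟨i, hd i i.2⟩ :=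
    measurable_pi_lambda _ fun i => measurable_pi_apply _
  have h := hstat d 1 _ (hr hS)
  refine Eq.trans ?_ h.symm
  congr 1
  ext ω
  simp only [Set.mem_preimage, Function.comp_apply, mem_cylinder, Set.mem_ofPred_eq]
  have : s.restrict (shift fun i => X i ω) = fun i : s => X (1 + i) ω := by
    funext i
    simp [shift, add_comm]
  rw [this]

theorem IsErgodic.ergodic_shift [IsProbabilityMeasure P] (herg : IsErgodic P X)
    (hstat : IsStationary P X) (hX : ∀ i, Measurable (X i)) :
    Ergodic shift (P.map fun ω i => X i ω) := by
  have hXm : Measurable fun ω i => X i ω := measurable_pi_lambda _ hX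
  have := Measure.isProbabilityMeasure_map (μ := P) hXm.aemeasurable
  refine ⟨hstat.measurePreserving_shift hX, ⟨fun A hA hinv => ?_⟩⟩
  have h0 : {ω | (fun i => X (0 + i) ω) ∈ A} = {ω | (fun i => X i ω) ∈ A} := by
    simp only [zero_add]
  have h1 : {ω | (fun i => X (0 + 1 + i) ω) ∈ A} = {ω | (fun i => X i ω) ∈ A} := by
    ext ω
    have : (fun i => X (0 + 1 + i) ω) = shift fun i => X i ω := by
      funext i
      simp [shift, add_comm]
    rw [Set.mem_ofPred_eq, Set.mem_ofPred_eq, this]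
    exact Set.ext_iff.1 hinv _
  have h2 := herg 0 A hA (by rw [h0, h1]; simp)
  have h3 : (P.map fun ω i => X i ω) A = P {ω | (fun i => X i ω) ∈ A} :=
    Measure.map_apply hXm hA
  rw [h0, ← h3] at h2
  rw [eventuallyConst_set']
  rcases h2 with h2 | h2
  · exact Or.inl (ae_eq_empty.2 h2)
  · refine Or.inr (ae_eq_univ.2 ?_)
    rw [prob_compl_eq_zero_iff hA]
    exact h2

end Sequence

/-! ### From the counts of pairs to the normalized diagrams. -/

theorem isFiniteMeasure_xi (x : ℕ → ℝ) (n : ℕ) : IsFiniteMeasure (xi x n) :=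
  ⟨by rw [xi_apply x n MeasurableSet.univ]; exact ENNReal.natCast_lt_top _⟩

theorem xi_real (x : ℕ → ℝ) (n : ℕ) {B : Set Delta} (hB : MeasurableSet B) :
    (xi x n).real B = pointCount x n (Subtype.val '' B) := by
  rw [Measure.real, xi_apply x n hB, ENNReal.toReal_natCast]
  rfl

end SublevelPersistence

end

theorem mainTheorem6 {Ω : Type*} [MeasurableSpace Ω] (P : Measure Ω) [IsProbabilityMeasure P]
    (X : ℕ → Ω → ℝ) (hX : ∀ i, Measurable (X i))
    (hstat : SublevelPersistence.IsStationary P X)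
    (herg : SublevelPersistence.IsErgodic P X)
    (hdens : ∀ i, HasPDF (X i) P volume)
    (hne : P {ω | X 0 ω = X 1 ω} = 0) :
    ∃ ξ₀ : Measure SublevelPersistence.Delta, IsProbabilityMeasure ξ₀ ∧
      -- almost surely, the normalized measures converge weakly to `ξ₀`, which determines `ξ₀`
      (∀ᵐ ω ∂P, ∀ g : SublevelPersistence.Delta →ᵇ ℝ,
        Tendsto
          (fun n : ℕ => (∫ p, g p ∂(SublevelPersistence.xi (fun i => X i ω) n)) /
            (SublevelPersistence.xi (fun i => X i ω) n).real Set.univ)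
          atTop (𝓝 (∫ p, g p ∂ξ₀))) ∧
      -- almost surely, the lifetime tails converge uniformly
      (∀ᵐ ω ∂P,
        Tendsto
          (fun n : ℕ => ⨆ l : Set.Ici (0 : ℝ),
            |(SublevelPersistence.xi (fun i => X i ω) n).real
                (SublevelPersistence.deltaLifetime l) /
              (SublevelPersistence.xi (fun i => X i ω) n).real Set.univ -
              ξ₀.real (SublevelPersistence.deltaLifetime l)|)
          atTop (𝓝 0)) := by
  classical
  have hXm : Measurable fun ω i => X i ω := measurable_pi_lambda _ hX
  set Q : Measure (ℕ → ℝ) := P.map fun ω i => X i ω with hQdef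
  have hQ1 : IsProbabilityMeasure Q := Measure.isProbabilityMeasure_map hXm.aemeasurable
  have hQ : Ergodic SublevelPersistence.shift Q := herg.ergodic_shift hstat hX
  have hatom : ∀ a, Q {x | x 0 = a} = 0 := fun a => by
    have h1 : Q {x | x 0 = a} = P.map (X 0) {a} := by
      rw [hQdef, Measure.map_apply hXm
        (measurableSet_eq_fun (measurable_pi_apply 0) measurable_const),
        Measure.map_apply (hX 0) (measurableSet_singleton a)]
      rfl
    rw [h1]
    have := hdens 0
    exact HasPDF.absolutelyContinuous (X := X 0) (ℙ := P) (μ := volume) (measure_singleton a)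
  have hne' : Q {x | x 0 = x 1} = 0 := by
    rw [hQdef, Measure.map_apply hXm
      (measurableSet_eq_fun (measurable_pi_apply 0) (measurable_pi_apply 1))]
    exact hne
  set ν := SublevelPersistence.limitLaw hQ.toMeasurePreserving with hν
  have hν1 : IsProbabilityMeasure ν := SublevelPersistence.isProbabilityMeasure_limitLaw hQ hatom
  have hΔ0 : ν SublevelPersistence.deltaSet ≠ 0 :=
    SublevelPersistence.limitLaw_deltaSet_ne_zero hQ hatom hne'
  have hΔ : MeasurableSet SublevelPersistence.deltaSet := SublevelPersistence.measurableSet_deltaSet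
  have hcomap : ∀ B : Set SublevelPersistence.Delta,
      (ν.comap Subtype.val : Measure SublevelPersistence.Delta) B = ν (Subtype.val '' B) :=
    fun B => comap_subtype_coe_apply hΔ ν B
  have himg : (Subtype.val '' (Set.univ : Set SublevelPersistence.Delta)) =
      SublevelPersistence.deltaSet := by
    rw [Set.image_univ]; exact Subtype.range_coe
  -- The limit law conditioned on Δ.
  set ξ₀ : Measure SublevelPersistence.Delta :=
    (ν SublevelPersistence.deltaSet)⁻¹ • ν.comap Subtype.val with hξ₀
  have hξ1 : IsProbabilityMeasure ξ₀ := ⟨by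
    rw [hξ₀, Measure.smul_apply, hcomap, himg, smul_eq_mul,
      ENNReal.inv_mul_cancel hΔ0 (measure_ne_top _ _)]⟩
  have hξr : ∀ B, ξ₀.real B = ν.real (Subtype.val '' B) / ν.real SublevelPersistence.deltaSet := by
    intro B
    rw [hξ₀, measureReal_ennreal_smul_apply, ENNReal.toReal_inv, div_eq_inv_mul]
    congr 1
    exact congrArg ENNReal.toReal (hcomap B)
  obtain ⟨F, hFc, hFm, hF⟩ := SublevelPersistence.exists_countable_determining ξ₀
  have hpos : 0 < ν.real SublevelPersistence.deltaSet :=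
    ENNReal.toReal_pos hΔ0 (measure_ne_top _ _)
  -- Countability of `F` gives one null set for all of its members; the normalized measure of `B` is
  -- a quotient of two frequencies, in which `n` cancels.
  have hae : ∀ᵐ x ∂Q, (∀ᶠ n in atTop, SublevelPersistence.xi x n Set.univ ≠ 0) ∧
      ∀ B ∈ F, Tendsto (fun n => (SublevelPersistence.xi x n).real B /
        (SublevelPersistence.xi x n).real Set.univ) atTop (𝓝 (ξ₀.real B)) := by
    have h1 := SublevelPersistence.ae_tendsto_card_div hQ hatom hΔ
    have h2 := (ae_ball_iff hFc).2 fun B hB => SublevelPersistence.ae_tendsto_card_div hQ hatom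
      (hΔ.subtype_image (hFm B hB))
    filter_upwards [h1, h2] with x hx1 hx2
    refine ⟨?_, fun B hB => ?_⟩
    · filter_upwards [hx1.eventually_const_lt hpos] with n hn h0
      have h3 := SublevelPersistence.xi_real x n MeasurableSet.univ
      rw [Measure.real, h0, himg, ENNReal.toReal_zero] at h3
      rw [← h3, zero_div] at hn
      exact lt_irrefl _ hn
    · rw [hξr B]
      refine ((hx2 B hB).div hx1 hpos.ne').congr' ?_
      filter_upwards [eventually_gt_atTop 0] with n hn
      rw [SublevelPersistence.xi_real x n (hFm B hB),
        SublevelPersistence.xi_real x n MeasurableSet.univ, himg]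
      exact div_div_div_cancel_right₀ (Nat.cast_ne_zero.2 hn.ne') _ _
  have hconv := ae_of_ae_map hXm.aemeasurable hae
  refine ⟨ξ₀, hξ1, ?_, ?_⟩
  · filter_upwards [hconv] with ω hω
    exact (hF _ (fun n => SublevelPersistence.isFiniteMeasure_xi _ n) hω.1 hω.2).1
  · filter_upwards [hconv] with ω hω
    exact (hF _ (fun n => SublevelPersistence.isFiniteMeasure_xi _ n) hω.1 hω.2).2
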